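/- Fix the signature $\{\cdot,{}^{-1},1\}$ of groups. For $\mathcal{L}_{\omega_1,\omega}$ formulas over this signature and $\alpha\in\mathbb{N}$: a formula is $\Sigma_0$ (equivalently $\Pi_0$) if it is finitary and quantifier-free; for $\alpha>0$, a $\Sigma_\alpha$ formula is a countable disjunction of formulas $\exists\bar x\,\psi$ with $\bar x$ a finite tuple of variables and $\psi$ a $\Pi_\beta$ formula for some $\beta<\alpha$, and a $\Pi_\alpha$ formula is a countable conjunction of formulas $\forall\bar x\,\psi$ with $\bar x$ a finite tuple and $\psi$ a $\Sigma_\beta$ formula for some $\beta<\alpha$. A formula is computable if (hereditarily, through indices) all infinitary conjunctions and disjunctions in it are over c.e. sets. A Scott sentence of a countable structure $\mathcal{A}$ is a sentence whose countable models are exactly the isomorphic copies of $\mathcal{A}$. For a group $G$ let $G_1=G$ and $G_{k+1}=[G_k,G]$. For $p\in\mathbb{N}$ let $N_{p,\infty}=F_\omega/(F_\omega)_{p+1}$ be the free nilpotent group of class $p$ on countably infinitely many generators, where $F_\omega$ is the free group on countably infinitely many generators (for $p=0$ this is the trivial group). **Corollary.** For every $p\in\mathbb{N}$, the group $N_{p,\infty}$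 has a computable $\Pi_3$ Scott sentence; that is, there is a computable $\Pi_3$ sentence of $\mathcal{L}_{\omega_1,\omega}$ whose countable models, among all structures of the signature $\{\cdot,{}^{-1},1\}$, are exactly the isomorphic copies of $N_{p,\infty}$. -/

import Mathlib

universe u v

/-- The free nilpotent group of class `p` on the set `α`, that is `F / F_{p+1}`, where `F` is the free
group on `α` and `F_1 = F`, `F_{k+1} = [F_k, F]` is its lower central series (Mathlib's
`lowerCentralSeries` starts at `0`, so that `F_{p+1}` is its `p`-th term). -/
abbrev FreeNilpotentGroup (p : ℕ) (α : Type*) : Type _ :=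
  FreeGroup α ⧸ (⊤ : Subgroup (FreeGroup α)).lowerCentralSeries p

namespace GroupLogic

/-- Terms of the signature `{·, ⁻¹, 1}` in the variables `x_0, …, x_{n-1}`. -/
inductive Term (n : ℕ) : Type
  | var (i : Fin n) : Term n
  | one : Term n
  | mul (s t : Term n) : Term n
  | inv (t : Term n) : Term n

/-- The value of a term in an arbitrary structure `M` of the signature `{·, ⁻¹, 1}`. -/
def Term.value {n : ℕ} {M : Type*} [Mul M] [Inv M] [One M] (v : Fin n → M) : Term n → M
  | .var i => v i
  | .one => 1
  | .mul s t => s.value v * t.value v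
  | .inv t => (t.value v)⁻¹

/-- The Gödel number of a term. -/
def Term.code {n : ℕ} : Term n → ℕ
  | .var i => Nat.pair 0 i
  | .one => Nat.pair 1 0
  | .mul s t => Nat.pair 2 (Nat.pair s.code t.code)
  | .inv t => Nat.pair 3 t.code

/-- Formulas of `L_{ω₁,ω}` over the signature `{·, ⁻¹, 1}` with free variables among
`x_0, …, x_{n-1}`. A quantifier binds the variable `x_n` of a formula in `x_0, …, x_n`. The conjunctions
`iAnd` and disjunctions `iOr` are over arbitrary countable families, possibly finite or empty, presented
as families indexed by a set of natural numbers. -/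
inductive Formula : ℕ → Type
  | eq {n : ℕ} (s t : Term n) : Formula n
  | neg {n : ℕ} (φ : Formula n) : Formula n
  | and {n : ℕ} (φ ψ : Formula n) : Formula n
  | or {n : ℕ} (φ ψ : Formula n) : Formula n
  | all {n : ℕ} (φ : Formula (n + 1)) : Formula n
  | ex {n : ℕ} (φ : Formula (n + 1)) : Formula n
  | iAnd {n : ℕ} (s : Set ℕ) (f : s → Formula n) : Formula n
  | iOr {n : ℕ} (s : Set ℕ) (f : s → Formula n) : Formula n

/-- A sentence is a formula without free variables. -/
abbrev Sentence : Type := Formula 0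

namespace Formula

/-- Truth of a formula in a structure `M` of the signature `{·, ⁻¹, 1}` under the assignment `v`. -/
def Realize {M : Type*} [Mul M] [Inv M] [One M] : {n : ℕ} → Formula n → (Fin n → M) → Prop
  | _, .eq s t, v => s.value v = t.value v
  | _, .neg φ, v => ¬ φ.Realize v
  | _, .and φ ψ, v => φ.Realize v ∧ ψ.Realize v
  | _, .or φ ψ, v => φ.Realize v ∨ ψ.Realize v
  | _, .all φ, v => ∀ a : M, φ.Realize (Fin.snoc v a)
  | _, .ex φ, v => ∃ a : M, φ.Realize (Fin.snoc v a)
  | _, .iAnd s f, v => ∀ i : s, (f i).Realize v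
  | _, .iOr s f, v => ∃ i : s, (f i).Realize v

/-- Universal quantification over a tuple of `k` variables. -/
def alls {n : ℕ} : (k : ℕ) → Formula (n + k) → Formula n
  | 0, φ => φ
  | k + 1, φ => alls k (.all φ)

/-- Existential quantification over a tuple of `k` variables. -/
def exs {n : ℕ} : (k : ℕ) → Formula (n + k) → Formula n
  | 0, φ => φ
  | k + 1, φ => exs k (.ex φ)

/-- Finitary quantifier-free formulas. -/
inductive IsOpen : {n : ℕ} → Formula n → Prop
  | eq {n : ℕ} (s t : Term n) : IsOpen (.eq s t)
  | neg {n : ℕ} {φ : Formula n} : IsOpen φ → IsOpen (.neg φ)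
  | and {n : ℕ} {φ ψ : Formula n} : IsOpen φ → IsOpen ψ → IsOpen (.and φ ψ)
  | or {n : ℕ} {φ ψ : Formula n} : IsOpen φ → IsOpen ψ → IsOpen (.or φ ψ)

mutual

/-- `Σ_α` formulas, for finite `α`. A `Σ_0` formula is a finitary quantifier-free formula. For `α > 0` a
`Σ_α` formula is a countable disjunction of formulas `∃ x̄, ψ`, with `x̄` a finite tuple of variables
and `ψ` a `Π_β` formula for some `β < α` (tuple and `β` may vary with the disjunct). -/
inductive IsSigma : ℕ → {n : ℕ} → Formula n → Prop
  | zero {n : ℕ} {φ : Formula n} : IsOpen φ → IsSigma 0 φ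
  | pos {α n : ℕ} (hα : 0 < α) (s : Set ℕ) (k β : s → ℕ) (ψ : (i : s) → Formula (n + k i)) :
      (∀ i, β i < α) → (∀ i, IsPi (β i) (ψ i)) → IsSigma α (.iOr s fun i => exs (k i) (ψ i))

/-- `Π_α` formulas, for finite `α`. A `Π_0` formula is a finitary quantifier-free formula. For `α > 0` a
`Π_α` formula is a countable conjunction of formulas `∀ x̄, ψ`, with `x̄` a finite tuple of variables
and `ψ` a `Σ_β` formula for some `β < α` (tuple and `β` may vary with the conjunct). -/
inductive IsPi : ℕ → {n : ℕ} → Formula n → Prop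
  | zero {n : ℕ} {φ : Formula n} : IsOpen φ → IsPi 0 φ
  | pos {α n : ℕ} (hα : 0 < α) (s : Set ℕ) (k β : s → ℕ) (ψ : (i : s) → Formula (n + k i)) :
      (∀ i, β i < α) → (∀ i, IsSigma (β i) (ψ i)) → IsPi α (.iAnd s fun i => alls (k i) (ψ i))

end

end Formula

/-- The `e`-th computably enumerable set of natural numbers: the domain of the `e`-th partial
computable function. -/
def ceSet (e : ℕ) : Set ℕ :=
  {x | ((Denumerable.ofNat Nat.Partrec.Code e).eval x).Dom}

namespace Formula

/-- `φ.HasIndex c` says that the natural number `c` is an index of `φ`. Finitary constructions are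
Gödel numbered. An index of an infinitary conjunction (or disjunction) gives the number `e` of a
c.e. set which consists of indices of the conjuncts, at least one for each conjunct. -/
def HasIndex : {n : ℕ} → Formula n → ℕ → Prop
  | _, .eq s t, c => c = Nat.pair 0 (Nat.pair s.code t.code)
  | _, .neg φ, c => ∃ a, φ.HasIndex a ∧ c = Nat.pair 1 a
  | _, .and φ ψ, c => ∃ a b, φ.HasIndex a ∧ ψ.HasIndex b ∧ c = Nat.pair 2 (Nat.pair a b)
  | _, .or φ ψ, c => ∃ a b, φ.HasIndex a ∧ ψ.HasIndex b ∧ c = Nat.pair 3 (Nat.pair a b)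
  | _, .all φ, c => ∃ a, φ.HasIndex a ∧ c = Nat.pair 4 a
  | _, .ex φ, c => ∃ a, φ.HasIndex a ∧ c = Nat.pair 5 a
  | _, .iAnd s f, c => ∃ e, c = Nat.pair 6 e ∧
      (∀ i : s, ∃ a ∈ ceSet e, (f i).HasIndex a) ∧ ∀ a ∈ ceSet e, ∃ i : s, (f i).HasIndex a
  | _, .iOr s f, c => ∃ e, c = Nat.pair 7 e ∧
      (∀ i : s, ∃ a ∈ ceSet e, (f i).HasIndex a) ∧ ∀ a ∈ ceSet e, ∃ i : s, (f i).HasIndex a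

/-- A formula is computable if all infinitary conjunctions and disjunctions in it are over c.e. sets. -/
def IsComputable {n : ℕ} (φ : Formula n) : Prop := ∃ c, φ.HasIndex c

end Formula

/-- The structure `M` is a model of the sentence `φ`. -/
def Models (M : Type*) [Mul M] [Inv M] [One M] (φ : Sentence) : Prop :=
  φ.Realize (Fin.elim0 : Fin 0 → M)

/-- Isomorphism of structures of the signature `{·, ⁻¹, 1}`. -/
def Isomorphic (M N : Type*) [Mul M] [Inv M] [One M] [Mul N] [Inv N] [One N] : Prop :=
  ∃ e : M ≃* N, e 1 = 1 ∧ ∀ x, e x⁻¹ = (e x)⁻¹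

/-- `φ` is a Scott sentence of `A`: the countable models of `φ`, among all structures of the signature
`{·, ⁻¹, 1}`, are exactly the isomorphic copies of `A`. -/
def IsScottSentence (φ : Sentence) (A : Type v) [Mul A] [Inv A] [One A] : Prop :=
  ∀ (M : Type u) [Mul M] [Inv M] [One M] [Countable M], Models M φ ↔ Isomorphic M A

end GroupLogic

-- Call a tuple primitive if its images in the abelianization are independent modulo every natural
-- number `d`, where `d = 0` means independence over ℤ. A failure is witnessed by a single equation
-- `u = z ^ d * c` between a word in the tuple, a power and a product of commutators, so primitivity
-- is Π_1. Write γ for `lowerCentralSeries p` of the free group. Besides the group axioms, the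
-- sentence says that words of γ vanish; that a word vanishing on a primitive tuple lies in γ; and
-- that, given a primitive tuple and an element, the tuple extends to a longer primitive one (for `p
-- > 0`) generating that element. The last clause has the form ∀ (Π_1 → ∃ Π_1), which is Π_3; the
-- others are simpler.
--
-- In the free nilpotent group of positive class, a primitive tuple spans a pure subgroup of the
-- abelianization, so its image extends to a basis (`exists_basis_nat_extending`). Lifts of a basis
-- generate freely (`bijective_endo`), because a subgroup of a nilpotent group that generates modulo
-- commutators is everything (`eq_top_of_sup_commutator_eq_top`). Conversely, in a countable model
-- the extension clause, iterated along an enumeration, yields a generating sequence whose relations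
-- are exactly γ (`IsFreeNilpotentLike.nonempty_mulEquiv`).
--
-- For computability, γ is enumerated by primitive recursive words, equality in the free group is
-- decided by reduction, and indices of the infinitary connectives come uniformly from the s-m-n
-- theorem (`exists_ceSet_eq_range`).

open Module Encodable

-- Pure families in free abelian groups

/-- A finite family in a finite free abelian group that stays independent modulo every `d` extends to
a basis. -/
theorem exists_basis_sum_extending {V : Type*} [AddCommGroup V] [Module.Finite ℤ V]
    [Module.Free ℤ V] {n : ℕ} (y : Fin n → V)
    (hy : ∀ (d : ℕ) (t : Fin n → ℤ) (z : V), ∑ i, t i • y i = d • z → ∀ i, (d : ℤ) ∣ t i) :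
    ∃ (m : ℕ) (b : Basis (Fin n ⊕ Fin m) ℤ V), ∀ i, b (Sum.inl i) = y i := by
  have hli : LinearIndependent ℤ y := by
    rw [Fintype.linearIndependent_iff]
    intro t ht i
    -- The case `d = 0`: divisibility by 0 means being 0.
    simpa using hy 0 t 0 (by simpa using ht) i
  let P := Submodule.span ℤ (Set.range y)
  -- The span is pure: if `k • v` lies in it, `hy` makes its coefficients divisible by `k`, and `k`
  -- cancels. The quotient, finitely generated and torsion-free, is free, so the projection splits.
  have htf : IsTorsionFree ℤ (V ⧸ P) := by
    rw [Module.isTorsionFree_iff_smul_eq_zero]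
    intro r q hq
    obtain ⟨v, rfl⟩ := P.mkQ_surjective q
    rw [or_iff_not_imp_left]
    intro hr
    obtain ⟨k, hk⟩ := Int.eq_nat_or_neg r
    have hkv : k • v ∈ P := by
      have : r • v ∈ P := by
        rw [← Submodule.Quotient.mk_eq_zero, ← Submodule.mkQ_apply, map_smul, hq]
      rcases hk with rfl | rfl
      · simpa using this
      · simpa using this
    obtain ⟨t, ht⟩ := (Submodule.mem_span_range_iff_exists_fun ℤ).1 hkv
    choose t' ht' using hy k t v ht
    have hk0 : (k : ℤ) ≠ 0 := by omega
    rw [Submodule.mkQ_apply, Submodule.Quotient.mk_eq_zero]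
    refine (Submodule.mem_span_range_iff_exists_fun ℤ).2 ⟨t', ?_⟩
    have hV : IsTorsionFree ℤ V := inferInstance
    refine smul_right_injective V hk0 ?_
    simp only [Finset.smul_sum, smul_smul, ← ht', ht, natCast_zsmul]
  obtain ⟨s, hs⟩ := Module.projective_lifting_property P.mkQ LinearMap.id P.mkQ_surjective
  have hs' : ∀ x, P.mkQ (s x) = x := fun x => LinearMap.congr_fun hs x
  have hc : IsCompl P (LinearMap.range s) := by
    constructor
    · rw [Submodule.disjoint_def]
      rintro _ hx ⟨q, rfl⟩
      have : P.mkQ (s q) = 0 := by simpa using hx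
      rw [hs'] at this
      simp [this]
    · rw [codisjoint_iff, eq_top_iff]
      intro x _
      rw [Submodule.mem_sup]
      refine ⟨x - s (P.mkQ x), ?_, s (P.mkQ x), ⟨_, rfl⟩, by simp⟩
      rw [← Submodule.Quotient.mk_eq_zero, ← Submodule.mkQ_apply, map_sub, hs', sub_self]
  let c := Module.finBasis ℤ (LinearMap.range s)
  refine ⟨_, ((Basis.span hli).prod c).map (Submodule.prodEquivOfIsCompl _ _ hc), fun i => ?_⟩
  simp [Basis.span_apply]

/-- Finitely many vectors live in the first `K` coordinates. The case of finite rank applies there,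
and the unit vectors of the remaining coordinates complete the basis. -/
theorem exists_basis_nat_extending {n : ℕ} (y : Fin n → ℕ →₀ ℤ)
    (hy : ∀ (d : ℕ) (t : Fin n → ℤ) (z : ℕ →₀ ℤ), ∑ i, t i • y i = d • z → ∀ i, (d : ℤ) ∣ t i) :
    ∃ b : Basis ℕ ℤ (ℕ →₀ ℤ), ∀ i : Fin n, b i = y i := by
  obtain ⟨K, hK⟩ : ∃ K : ℕ, ∀ i, ∀ j, K ≤ j → y i j = 0 := by
    refine ⟨(Finset.univ.biUnion fun i => (y i).support).sup id + 1, fun i j hj => ?_⟩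
    by_contra h
    have := Finset.le_sup (f := id) (b := j) (s := Finset.univ.biUnion fun i => (y i).support)
      (Finset.mem_biUnion.2 ⟨i, Finset.mem_univ _, Finsupp.mem_support_iff.2 h⟩)
    simp only [id] at this
    omega
  let e : (ℕ →₀ ℤ) ≃ₗ[ℤ] (Fin K →₀ ℤ) × (ℕ →₀ ℤ) :=
    (Finsupp.domLCongr (finSumNatEquiv K).symm).trans (Finsupp.sumFinsuppLEquivProdFinsupp ℤ)
  have h2 : ∀ i, (e (y i)).2 = 0 := fun i => by
    ext j
    simpa [e] using hK i (K + j) (by omega)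
  obtain ⟨m, b, hb⟩ := exists_basis_sum_extending (fun i => (e (y i)).1) fun d t z h i => by
    refine hy d t (e.symm (z, 0)) (e.injective ?_) i
    refine Prod.ext ?_ ?_
    · simpa [Prod.fst_sum] using h
    · simp [Prod.snd_sum, h2]
  refine ⟨((b.prod Finsupp.basisSingleOne).map e.symm).reindex
    ((Equiv.sumAssoc _ _ _).trans (((Equiv.refl _).sumCongr (finSumNatEquiv m)).trans
      (finSumNatEquiv n))), fun i => ?_⟩
  rw [Basis.reindex_apply, Basis.map_apply, LinearEquiv.symm_apply_eq]
  have : ((Equiv.sumAssoc (Fin n) (Fin m) ℕ).trans (((Equiv.refl _).sumCongr (finSumNatEquiv m)).trans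
      (finSumNatEquiv n))).symm i = Sum.inl (Sum.inl i) := by
    rw [Equiv.symm_apply_eq]; simp
  rw [this]
  refine Prod.ext ?_ ?_ <;> simp [hb, h2]

-- Generation of nilpotent groups modulo commutators

open scoped commutatorElement in
/-- In a nilpotent group, a subgroup which together with the commutator subgroup generates the group
is the whole group. -/
theorem eq_top_of_sup_commutator_eq_top {G : Type*} [Group G] [Group.IsNilpotent G] :
    ∀ H : Subgroup G, H ⊔ commutator G = ⊤ → H = ⊤ := by
  refine Group.nilpotent_center_quotient_ind
    (P := fun G _ _ => ∀ H : Subgroup G, H ⊔ commutator G = ⊤ → H = ⊤) G ?_ ?_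
  · intro G _ _ H _
    exact Subsingleton.elim _ _
  · intro G _ _ ih H hH
    let q := QuotientGroup.mk' (Subgroup.center G)
    have hq : Function.Surjective q := QuotientGroup.mk'_surjective _
    have h1 : H.map q = ⊤ := by
      apply ih
      rw [← Subgroup.map_top_of_surjective q hq, ← hH, Subgroup.map_sup]
      congr 1
      rw [commutator_def, commutator_def, Subgroup.map_commutator,
        Subgroup.map_top_of_surjective q hq]
    -- By induction `H` is everything modulo the center. Central factors drop out of commutators, so
    -- every commutator of `G` is one of elements of `H`.
    have h2 : ∀ g : G, ∃ h ∈ H, ∃ z ∈ Subgroup.center G, g = h * z := fun g => by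
      have : q g ∈ H.map q := h1 ▸ Subgroup.mem_top _
      obtain ⟨h, hh, hhg⟩ := this
      exact ⟨h, hh, h⁻¹ * g, QuotientGroup.eq.1 hhg, by group⟩
    have h3 : commutator G ≤ H := by
      rw [commutator_def, Subgroup.commutator_le]
      rintro a - b -
      obtain ⟨h, hh, z, hz, rfl⟩ := h2 a
      obtain ⟨k, hk, w, hw, rfl⟩ := h2 b
      rw [Subgroup.mem_center_iff] at hz hw
      have : ⁅h * z, k * w⁆ = ⁅h, k⁆ := by
        have e1 : h * z * (k * w) = h * k * (z * w) := by
          rw [mul_assoc, ← mul_assoc z, ← hz k]; group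
        have e2 : k * w * (h * z) = k * h * (z * w) := by
          rw [mul_assoc, ← mul_assoc w, ← hw h, mul_assoc h, ← hz w]; group
        rw [commutatorElement_def, commutatorElement_def, mul_assoc _ (h * z)⁻¹, mul_assoc _ h⁻¹,
          ← mul_inv_rev, ← mul_inv_rev, e1, e2]
        group
      rw [this]
      exact H.mul_mem (H.mul_mem (H.mul_mem hh hk) (H.inv_mem hh)) (H.inv_mem hk)
    rwa [sup_eq_left.2 h3] at hH

-- Primitive tuples, words and exponents

/-- The sequence `f` with all entries from the `n`-th on replaced by `1`. -/
def truncate {G : Type*} [One G] (n : ℕ) (f : ℕ → G) (i : ℕ) : G := if i < n then f i else 1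

/-- The map from the free group on `ℕ` to the free abelian group on `ℕ`. -/
noncomputable def exponents : FreeGroup ℕ →* Multiplicative (ℕ →₀ ℤ) :=
  FreeGroup.lift fun i => Multiplicative.ofAdd (Finsupp.single i 1)

theorem exponents_of (i : ℕ) :
    exponents (FreeGroup.of i) = Multiplicative.ofAdd (Finsupp.single i 1) :=
  FreeGroup.lift_apply_of

/-- The first `n` entries of `f` are independent in the abelianization modulo `d`, for every `d`. -/
def IsPrimitiveTuple {G : Type*} [Group G] (n : ℕ) (f : ℕ → G) : Prop :=
  ∀ (d : ℕ) (u : FreeGroup ℕ) (z : G), ∀ c ∈ commutator G,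
    FreeGroup.lift (truncate n f) u = z ^ d * c →
      ∀ i < n, (d : ℤ) ∣ (exponents u).toAdd i

theorem IsPrimitiveTuple.zero {G : Type*} [Group G] (f : ℕ → G) : IsPrimitiveTuple 0 f :=
  fun _ _ _ _ _ _ _ hi => absurd hi (Nat.not_lt_zero _)

theorem truncate_congr {G : Type*} [One G] {n : ℕ} {f g : ℕ → G} (h : ∀ i < n, f i = g i) :
    truncate n f = truncate n g := by
  funext i
  by_cases hi : i < n <;> simp [truncate, hi, h]

theorem isPrimitiveTuple_congr {G : Type*} [Group G] {n : ℕ} {f g : ℕ → G}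
    (h : ∀ i < n, f i = g i) : IsPrimitiveTuple n f ↔ IsPrimitiveTuple n g := by
  rw [IsPrimitiveTuple, truncate_congr h, IsPrimitiveTuple]

/-- Moving the truncation from the tuple to the word reduces evaluation at a finite tuple to the
homomorphism given by the whole sequence. -/
theorem lift_truncate {G : Type*} [Group G] (n : ℕ) (f : ℕ → G) (u : FreeGroup ℕ) :
    FreeGroup.lift (truncate n f) u =
      FreeGroup.lift f (FreeGroup.lift (truncate n FreeGroup.of) u) := by
  have : FreeGroup.lift (truncate n f) =
      (FreeGroup.lift f).comp (FreeGroup.lift (truncate n FreeGroup.of)) := by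
    ext i
    by_cases hi : i < n <;> simp [truncate, hi]
  rw [this]; rfl

/-- A word involves only finitely many letters. -/
theorem exists_lift_truncate_eq (u : FreeGroup ℕ) :
    ∃ n, ∀ m ≥ n, FreeGroup.lift (truncate m FreeGroup.of) u = u := by
  induction u using FreeGroup.induction_on with
  | C1 => exact ⟨0, fun _ _ => map_one _⟩
  | of i => exact ⟨i + 1, fun m hm => by simp [truncate, Nat.lt_of_succ_le hm]⟩
  | inv_of i h => obtain ⟨n, h⟩ := h; exact ⟨n, fun m hm => by rw [map_inv, h m hm]⟩
  | mul x y hx hy =>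
    obtain ⟨n, hx⟩ := hx
    obtain ⟨k, hy⟩ := hy
    exact ⟨max n k, fun m hm => by
      rw [map_mul, hx m (le_trans (le_max_left _ _) hm), hy m (le_trans (le_max_right _ _) hm)]⟩

theorem exponents_lift_truncate (n : ℕ) (u : FreeGroup ℕ) {i : ℕ} (hi : i < n) :
    (exponents (FreeGroup.lift (truncate n FreeGroup.of) u)).toAdd i = (exponents u).toAdd i := by
  induction u using FreeGroup.induction_on with
  | C1 => simp
  | of j =>
    by_cases hj : j < n
    · simp [truncate, hj]
    · have : j ≠ i := by omega
      simp [truncate, hj, exponents_of, this]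
  | inv_of j h => simpa using h
  | mul x y hx hy => simp [hx, hy]

theorem exponents_surjective : Function.Surjective exponents := by
  intro v
  induction v using Multiplicative.rec with | _ v =>
  induction v using Finsupp.induction_linear with
  | zero => exact ⟨1, map_one _⟩
  | add f g hf hg =>
    obtain ⟨u, hu⟩ := hf
    obtain ⟨v, hv⟩ := hg
    exact ⟨u * v, by rw [map_mul, hu, hv]; rfl⟩
  | single i k =>
    refine ⟨FreeGroup.of i ^ k, ?_⟩
    rw [map_zpow, exponents_of, ← ofAdd_zsmul]
    simp

/-- For the first inclusion, the free abelian group maps back to the abelianization by sending unit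
vectors to classes of generators, and the composite with `exponents` is the abelianization map. -/
theorem ker_exponents : exponents.ker = commutator (FreeGroup ℕ) := by
  apply le_antisymm
  · intro u hu
    rw [← Abelianization.ker_of]
    let k : Multiplicative (ℕ →₀ ℤ) →* Abelianization (FreeGroup ℕ) :=
      AddMonoidHom.toMultiplicativeLeft (Finsupp.liftAddHom fun i =>
        zmultiplesHom _ (Additive.ofMul (Abelianization.of (FreeGroup.of i))))
    have hk : k.comp exponents = Abelianization.of := by
      ext i
      simp [k, exponents_of]
    rw [MonoidHom.mem_ker, ← hk, MonoidHom.comp_apply, MonoidHom.mem_ker.1 hu, map_one]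
  · exact Abelianization.commutator_subset_ker exponents

-- The free nilpotent group: lifting bases of the abelianization

namespace FreeNilpotentGroup

variable {p : ℕ}

/-- The quotient map from the free group. -/
abbrev mk (p : ℕ) : FreeGroup ℕ →* FreeNilpotentGroup p ℕ := QuotientGroup.mk' _

theorem mk_surjective : Function.Surjective (mk p) := QuotientGroup.mk'_surjective _

theorem lowerCentralSeries_eq_bot :
    (⊤ : Subgroup (FreeNilpotentGroup p ℕ)).lowerCentralSeries p = ⊥ := by
  rw [← Subgroup.map_top_of_surjective (mk p) mk_surjective, ← Subgroup.map_lowerCentralSeries,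
    Subgroup.map_eq_bot_iff, QuotientGroup.ker_mk']

instance : Group.IsNilpotent (FreeNilpotentGroup p ℕ) :=
  Subgroup.nilpotent_iff_lowerCentralSeries.2 ⟨p, lowerCentralSeries_eq_bot⟩

theorem lowerCentralSeries_le_ker_exponents (hp : p ≠ 0) :
    (⊤ : Subgroup (FreeGroup ℕ)).lowerCentralSeries p ≤ exponents.ker := by
  rw [ker_exponents, ← Subgroup.top_lowerCentralSeries_one]
  exact Subgroup.lowerCentralSeries_antitone _ (Nat.one_le_iff_ne_zero.2 hp)

/-- The map from the free nilpotent group of positive class to the free abelian group. -/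
noncomputable def abelianize (hp : p ≠ 0) : FreeNilpotentGroup p ℕ →* Multiplicative (ℕ →₀ ℤ) :=
  QuotientGroup.lift _ exponents (lowerCentralSeries_le_ker_exponents hp)

@[simp]
theorem abelianize_mk (hp : p ≠ 0) (u : FreeGroup ℕ) : abelianize hp (mk p u) = exponents u := rfl

theorem ker_abelianize (hp : p ≠ 0) :
    (abelianize hp).ker = commutator (FreeNilpotentGroup p ℕ) := by
  apply le_antisymm
  · intro x hx
    obtain ⟨u, rfl⟩ := mk_surjective x
    have hu : u ∈ commutator (FreeGroup ℕ) := by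
      rw [← ker_exponents]; exact hx
    have : mk p u ∈ (commutator (FreeGroup ℕ)).map (mk p) := ⟨u, hu, rfl⟩
    rwa [commutator_def, Subgroup.map_commutator, Subgroup.map_top_of_surjective _ mk_surjective]
      at this
  · exact Abelianization.commutator_subset_ker _

/-- An endomorphism which is surjective on the abelianization is surjective. -/
theorem surjective_of_abelianize {φ : FreeNilpotentGroup p ℕ →* FreeNilpotentGroup p ℕ}
    (hp : p ≠ 0) (h : ∀ x, ∃ y, abelianize hp (φ y) = abelianize hp x) : Function.Surjective φ := by
  rw [← MonoidHom.range_eq_top]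
  apply eq_top_of_sup_commutator_eq_top
  rw [eq_top_iff]
  intro x _
  obtain ⟨y, hy⟩ := h x
  have : (φ y)⁻¹ * x ∈ commutator (FreeNilpotentGroup p ℕ) := by
    rw [← ker_abelianize hp, MonoidHom.mem_ker, map_mul, map_inv, hy, inv_mul_cancel]
  have h2 := Subgroup.mul_mem_sup (show φ y ∈ φ.range from ⟨y, rfl⟩) this
  rwa [mul_inv_cancel_left] at h2

/-- The endomorphism with given values on the generators. -/
noncomputable def endo (g : ℕ → FreeNilpotentGroup p ℕ) :
    FreeNilpotentGroup p ℕ →* FreeNilpotentGroup p ℕ :=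
  QuotientGroup.lift _ (FreeGroup.lift g) (by
    rw [← Subgroup.map_eq_bot_iff, Subgroup.map_lowerCentralSeries, eq_bot_iff,
      ← lowerCentralSeries_eq_bot]
    exact Subgroup.lowerCentralSeries_mono _ le_top)

@[simp]
theorem endo_mk (g : ℕ → FreeNilpotentGroup p ℕ) (u : FreeGroup ℕ) :
    endo g (mk p u) = FreeGroup.lift g u := rfl

theorem hom_ext {G : Type*} [Group G] {φ ψ : FreeNilpotentGroup p ℕ →* G}
    (h : ∀ i, φ (mk p (FreeGroup.of i)) = ψ (mk p (FreeGroup.of i))) : φ = ψ := by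
  apply QuotientGroup.monoidHom_ext
  ext i
  exact h i

theorem abelianize_lift (hp : p ≠ 0) (g : ℕ → FreeNilpotentGroup p ℕ) (u : FreeGroup ℕ) :
    abelianize hp (FreeGroup.lift g u) = Multiplicative.ofAdd
      (Finsupp.linearCombination ℤ (fun i => (abelianize hp (g i)).toAdd) (exponents u).toAdd) := by
  let k : (ℕ →₀ ℤ) →+ (ℕ →₀ ℤ) :=
    (Finsupp.linearCombination ℤ (fun i => (abelianize hp (g i)).toAdd)).toAddMonoidHom
  have : (abelianize hp).comp (FreeGroup.lift g) =
      (AddMonoidHom.toMultiplicative k).comp exponents := by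
    ext i : 1
    simp [exponents_of, k]
  exact DFunLike.congr_fun this u

/-- A sequence which is a basis of the abelianization freely generates. -/
theorem bijective_endo (hp : p ≠ 0) {g : ℕ → FreeNilpotentGroup p ℕ} (b : Basis ℕ ℤ (ℕ →₀ ℤ))
    (hb : ∀ i, (abelianize hp (g i)).toAdd = b i) : Function.Bijective (endo g) := by
  have key : ∀ x, (abelianize hp (endo g x)).toAdd = b.repr.symm (abelianize hp x).toAdd := by
    intro x
    obtain ⟨u, rfl⟩ := mk_surjective x
    rw [endo_mk, abelianize_lift, abelianize_mk, Basis.repr_symm_apply]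
    simp [hb]
  have hsurj : Function.Surjective (endo g) := by
    refine surjective_of_abelianize hp fun x => ?_
    obtain ⟨u, hu⟩ := exponents_surjective (.ofAdd (b.repr (abelianize hp x).toAdd))
    refine ⟨mk p u, Multiplicative.toAdd.injective ?_⟩
    rw [key, abelianize_mk, hu, toAdd_ofAdd, LinearEquiv.symm_apply_apply]
  refine ⟨?_, hsurj⟩
  -- Preimages of the generators give a right inverse `endo h` of `endo g`. It is onto modulo
  -- commutators, where `endo g` acts as an invertible change of basis; hence it is onto, and `endo
  -- g` is injective.
  choose h hh using fun i => hsurj (mk p (FreeGroup.of i))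
  have hid : (endo g).comp (endo h) = MonoidHom.id _ := hom_ext fun i => by
    rw [MonoidHom.comp_apply, endo_mk, FreeGroup.lift_apply_of, hh, MonoidHom.id_apply]
  have hid' : ∀ x, endo g (endo h x) = x := fun x => DFunLike.congr_fun hid x
  have hs : Function.Surjective (endo h) := by
    refine surjective_of_abelianize hp fun x => ⟨endo g x, Multiplicative.toAdd.injective ?_⟩
    apply b.repr.symm.injective
    rw [← key, ← key, hid']
  intro x y hxy
  obtain ⟨x, rfl⟩ := hs x
  obtain ⟨y, rfl⟩ := hs y
  rw [hid', hid'] at hxy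
  rw [hxy]

/-- In the coordinates of `b`, the truncated word has its exponents as coordinates, while those of
`z ^ d * c` are divisible by `d`. -/
theorem isPrimitiveTuple_of_basis (hp : p ≠ 0) {g : ℕ → FreeNilpotentGroup p ℕ}
    (b : Basis ℕ ℤ (ℕ →₀ ℤ)) (hb : ∀ i, (abelianize hp (g i)).toAdd = b i) (n : ℕ) :
    IsPrimitiveTuple n g := by
  intro d u z c hc h i hi
  rw [lift_truncate] at h
  apply_fun fun x => (abelianize hp x).toAdd at h
  rw [← ker_abelianize hp, MonoidHom.mem_ker] at hc
  simp only [abelianize_lift, hb, toAdd_ofAdd, map_mul, map_pow, hc, mul_one, toAdd_pow] at h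
  apply_fun b.repr at h
  rw [Basis.repr_linearCombination, map_nsmul] at h
  rw [← exponents_lift_truncate n u hi, h]
  simp

/-- Primitive tuples of a free nilpotent group are initial segments of free generating sequences. -/
theorem exists_extension (hp : p ≠ 0) {n : ℕ} {f : ℕ → FreeNilpotentGroup p ℕ}
    (hf : IsPrimitiveTuple n f) :
    ∃ g : ℕ → FreeNilpotentGroup p ℕ, (∀ i < n, g i = f i) ∧ (∀ k, IsPrimitiveTuple k g) ∧
      Function.Bijective (endo g) := by
  obtain ⟨b, hb⟩ := exists_basis_nat_extending (fun i : Fin n => (abelianize hp (f i)).toAdd)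
    fun d t z h i => by
      -- Lifting `t` and `z` to words turns the linear relation into a relation in the group, up to
      -- an error in the commutator subgroup.
      obtain ⟨u, hu⟩ := exponents_surjective (.ofAdd (∑ i : Fin n, Finsupp.single (i : ℕ) (t i)))
      obtain ⟨v, hv⟩ := exponents_surjective (.ofAdd z)
      have hi : (exponents u).toAdd i = t i := by
        rw [hu, toAdd_ofAdd, Finsupp.finsetSum_apply, Finset.sum_eq_single i]
        · simp
        · intro j _ hj
          simp [Fin.val_ne_of_ne hj]
        · simp
      rw [← hi]
      refine hf d u (mk p v) ((mk p v ^ d)⁻¹ * FreeGroup.lift (truncate n f) u) ?_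
        (by rw [mul_inv_cancel_left]) i i.2
      rw [← ker_abelianize hp, MonoidHom.mem_ker, map_mul, map_inv, map_pow, abelianize_mk, hv,
        abelianize_lift, hu, inv_mul_eq_one, ← ofAdd_nsmul, ← h]
      congr 1
      simp [truncate]
  have hl : ∀ i, ∃ l, (abelianize hp l).toAdd = b i := fun i => by
    obtain ⟨u, hu⟩ := exponents_surjective (.ofAdd (b i))
    exact ⟨mk p u, by rw [abelianize_mk, hu, toAdd_ofAdd]⟩
  choose l hl using hl
  have hg : ∀ i, (abelianize hp (if i < n then f i else l i)).toAdd = b i := fun i => by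
    by_cases hi : i < n
    · rw [if_pos hi]
      exact (hb ⟨i, hi⟩).symm
    · rw [if_neg hi, hl]
  exact ⟨fun i => if i < n then f i else l i, fun i hi => if_pos hi,
    isPrimitiveTuple_of_basis hp b hg, bijective_endo hp b hg⟩

end FreeNilpotentGroup

-- Characterization among countable groups

/-- Group-theoretic conditions which characterize, among countable groups, the free nilpotent group of
class `p` on countably many generators. -/
structure IsFreeNilpotentLike (p : ℕ) (G : Type*) [Group G] : Prop where
  nilpotent : (⊤ : Subgroup G).lowerCentralSeries p = ⊥
  free : ∀ (n : ℕ) (f : ℕ → G) (w : FreeGroup ℕ), IsPrimitiveTuple n f →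
    FreeGroup.lift (truncate n f) w = 1 →
      FreeGroup.lift (truncate n FreeGroup.of) w ∈ (⊤ : Subgroup (FreeGroup ℕ)).lowerCentralSeries p
  extend : ∀ (n : ℕ) (f : ℕ → G) (x : G), IsPrimitiveTuple n f →
    ∃ (m : ℕ) (g : ℕ → G), (∀ i < n, g i = f i) ∧ IsPrimitiveTuple (n + (m + min p 1)) g ∧
      ∃ w, x = FreeGroup.lift (truncate (n + (m + min p 1)) g) w

namespace FreeNilpotentGroup

variable {p : ℕ}

instance : Subsingleton (FreeNilpotentGroup 0 ℕ) :=
  QuotientGroup.subsingleton_quotient_top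

theorem isFreeNilpotentLike : IsFreeNilpotentLike p (FreeNilpotentGroup p ℕ) := by
  refine ⟨lowerCentralSeries_eq_bot, fun n f w hf hw => ?_, fun n f x hf => ?_⟩
  · rcases eq_or_ne p 0 with rfl | hp
    · exact Subgroup.mem_top _
    obtain ⟨g, hgf, -, hg⟩ := exists_extension hp hf
    rw [← truncate_congr hgf, lift_truncate, ← endo_mk, ← map_one (endo g)] at hw
    exact (QuotientGroup.eq_one_iff _).1 (hg.1 hw)
  · rcases eq_or_ne p 0 with rfl | hp
    -- In the trivial group no tuple of positive length is primitive, so no growth can be demanded;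
    -- this is why the increment is `min p 1`.
    · exact ⟨0, f, fun _ _ => rfl, hf, 1, Subsingleton.elim _ _⟩
    obtain ⟨g, hgf, hgp, hg⟩ := exists_extension hp hf
    obtain ⟨y, rfl⟩ := hg.2 x
    obtain ⟨w, rfl⟩ := mk_surjective y
    obtain ⟨m, hm⟩ := exists_lift_truncate_eq w
    exact ⟨m, g, hgf, hgp _, w, by rw [lift_truncate, hm _ (by omega), endo_mk]⟩

end FreeNilpotentGroup

/-- Stage `k` extends the current primitive tuple so that it generates the `k`-th element of the
group. As the tuples grow strictly, they have an infinite limit `F`, which generates. Freeness puts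
the kernel of evaluation at `F` inside the lower central series, and nilpotency gives the converse.
-/
theorem IsFreeNilpotentLike.nonempty_mulEquiv {p : ℕ} {G : Type*} [Group G] [Countable G]
    (h : IsFreeNilpotentLike p G) : Nonempty (G ≃* FreeNilpotentGroup p ℕ) := by
  rcases eq_or_ne p 0 with rfl | hp
  · have : Subsingleton G := subsingleton_of_forall_eq 1 fun x => by
      have : x ∈ (⊤ : Subgroup G).lowerCentralSeries 0 := Subgroup.mem_top x
      rwa [h.nilpotent, Subgroup.mem_bot] at this
    exact ⟨⟨⟨fun _ => 1, fun _ => 1, fun _ => Subsingleton.elim _ _, fun _ => Subsingleton.elim _ _⟩,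
      fun _ _ => Subsingleton.elim _ _⟩⟩
  have hp1 : min p 1 = 1 := min_eq_right (Nat.one_le_iff_ne_zero.2 hp)
  obtain ⟨enum, henum⟩ := exists_surjective_nat G
  have step : ∀ (s : {s : ℕ × (ℕ → G) // IsPrimitiveTuple s.1 s.2}) (x : G),
      ∃ t : {s : ℕ × (ℕ → G) // IsPrimitiveTuple s.1 s.2}, s.1.1 < t.1.1 ∧
        (∀ i < s.1.1, t.1.2 i = s.1.2 i) ∧ ∃ w, x = FreeGroup.lift (truncate t.1.1 t.1.2) w := by
    rintro ⟨⟨n, f⟩, hf⟩ x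
    obtain ⟨m, g, h1, h2, h3⟩ := h.extend n f x hf
    exact ⟨⟨⟨_, g⟩, h2⟩, by simp only [hp1]; omega, h1, h3⟩
  choose next hlt hext hgen using step
  let S : ℕ → {s : ℕ × (ℕ → G) // IsPrimitiveTuple s.1 s.2} :=
    Nat.rec ⟨⟨0, fun _ => 1⟩, .zero _⟩ fun k s => next s (enum k)
  have hS : ∀ k, S (k + 1) = next (S k) (enum k) := fun _ => rfl
  have hmono : StrictMono fun k => (S k).1.1 := strictMono_nat_of_lt_succ fun k => by
    rw [hS]; exact hlt _ _
  have hagree : ∀ k l, k ≤ l → ∀ i < (S k).1.1, (S l).1.2 i = (S k).1.2 i := by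
    intro k l hkl i hi
    induction l, hkl using Nat.le_induction with
    | base => rfl
    | succ l hkl ih =>
      rw [hS, hext _ _ i (lt_of_lt_of_le hi (hmono.monotone hkl)), ih]
  -- By strict growth, the tuple at stage `i + 1` has more than `i` entries, and entry `i` is final
  -- from then on.
  let F : ℕ → G := fun i => (S (i + 1)).1.2 i
  have hF : ∀ k, ∀ i < (S k).1.1, F i = (S k).1.2 i := by
    intro k i hi
    have hi' : i < (S (i + 1)).1.1 := lt_of_lt_of_le (Nat.lt_succ_self i) (hmono.id_le (i + 1))
    rcases le_total k (i + 1) with hk | hk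
    · exact hagree _ _ hk i hi
    · exact (hagree _ _ hk i hi').symm
  have hprim : ∀ k, IsPrimitiveTuple (S k).1.1 F := fun k =>
    (isPrimitiveTuple_congr (hF k)).2 (S k).2
  have hsurj : Function.Surjective (FreeGroup.lift F) := by
    intro x
    obtain ⟨k, rfl⟩ := henum x
    obtain ⟨w, hw⟩ := hgen (S k) (enum k)
    rw [← hS, ← truncate_congr (hF (k + 1)), lift_truncate] at hw
    exact ⟨_, hw.symm⟩
  have hker : (FreeGroup.lift F).ker = (⊤ : Subgroup (FreeGroup ℕ)).lowerCentralSeries p := by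
    apply le_antisymm
    · intro w hw
      obtain ⟨n, hn⟩ := exists_lift_truncate_eq w
      have hn' := hn (S n).1.1 (hmono.id_le n)
      rw [← hn']
      refine h.free _ F w (hprim n) ?_
      rw [lift_truncate, hn']
      exact hw
    · rw [← Subgroup.map_eq_bot_iff, Subgroup.map_lowerCentralSeries, eq_bot_iff, ← h.nilpotent]
      exact Subgroup.lowerCentralSeries_mono _ le_top
  exact ⟨((QuotientGroup.quotientMulEquivOfEq hker.symm).trans
    (QuotientGroup.quotientKerEquivOfSurjective _ hsurj)).symm⟩

-- Primitive recursive operations on words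

theorem Primrec.list_replicate {α : Type*} [Primcodable α] :
    Primrec₂ fun (n : ℕ) (a : α) => List.replicate n a :=
  (Primrec.list_map (Primrec.list_range.comp Primrec.fst)
    (Primrec.snd.comp Primrec.fst).to₂).of_eq fun x => by simp [List.map_const']

theorem primrec_invRev : Primrec (FreeGroup.invRev : List (ℕ × Bool) → List (ℕ × Bool)) :=
  Primrec.list_reverse.comp (Primrec.list_map Primrec.id
    (Primrec.pair (Primrec.fst.comp Primrec.snd)
      (Primrec.not.comp (Primrec.snd.comp Primrec.snd))).to₂)

/-- Reduction is a right fold whose step either cancels a letter against the head or prepends it. -/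
theorem primrec_reduce : Primrec (FreeGroup.reduce : List (ℕ × Bool) → List (ℕ × Bool)) := by
  let h : (ℕ × Bool) → List (ℕ × Bool) → List (ℕ × Bool) := fun x l =>
    List.casesOn l [x] fun hd tl => if x.1 = hd.1 ∧ x.2 = not hd.2 then tl else x :: hd :: tl
  have hh : Primrec₂ h := by
    refine Primrec.list_casesOn (f := fun q : (ℕ × Bool) × List (ℕ × Bool) => q.2)
      (h := fun q r => if q.1.1 = r.1.1 ∧ q.1.2 = (not r.1.2) then r.2 else q.1 :: r.1 :: r.2)
      Primrec.snd
      (Primrec.list_cons.comp Primrec.fst (Primrec.const [])) ?_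
    refine Primrec.ite (c := fun x : ((ℕ × Bool) × List (ℕ × Bool)) × (ℕ × Bool) × List (ℕ × Bool) =>
      x.1.1.1 = x.2.1.1 ∧ x.1.1.2 = (not x.2.1.2)) (PrimrecPred.and ?_ ?_) ?_ ?_
    · exact Primrec.eq.comp (Primrec.fst.comp (Primrec.fst.comp Primrec.fst))
        (Primrec.fst.comp (Primrec.fst.comp Primrec.snd))
    · exact Primrec.eq.comp (Primrec.snd.comp (Primrec.fst.comp Primrec.fst))
        (Primrec.not.comp (Primrec.snd.comp (Primrec.fst.comp Primrec.snd)))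
    · exact Primrec.snd.comp Primrec.snd
    · exact Primrec.list_cons.comp (Primrec.fst.comp Primrec.fst)
        (Primrec.list_cons.comp (Primrec.fst.comp Primrec.snd) (Primrec.snd.comp Primrec.snd))
  refine (Primrec.list_foldr Primrec.id (Primrec.const [])
    (hh.comp (Primrec.fst.comp Primrec.snd) (Primrec.snd.comp Primrec.snd)).to₂).of_eq fun l => ?_
  induction l with
  | nil => rfl
  | cons x l ih => rw [FreeGroup.reduce.cons, ← ih]; rfl

/-- The words which represent elements of the lower central series of the free group, enumerated up to
equality in the free group. -/
def lowerCentralWord : ℕ → ℕ → List (ℕ × Bool)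
  | 0, j => ((decode j : Option (List (ℕ × Bool)))).getD []
  | p + 1, j => ((decode j : Option (List ((ℕ × List (ℕ × Bool)) × Bool))).getD []).flatMap fun t =>
      if t.2 then lowerCentralWord p t.1.1 ++ (t.1.2 ++
        (FreeGroup.invRev (lowerCentralWord p t.1.1) ++ FreeGroup.invRev t.1.2))
      else t.1.2 ++ (lowerCentralWord p t.1.1 ++
        (FreeGroup.invRev t.1.2 ++ FreeGroup.invRev (lowerCentralWord p t.1.1)))

theorem primrec_lowerCentralWord (p : ℕ) : Primrec (lowerCentralWord p) := by
  induction p with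
  | zero => exact Primrec.option_getD.comp Primrec.decode (Primrec.const [])
  | succ p ih =>
    have ha := ih.comp (Primrec.fst.comp (Primrec.fst.comp
      (Primrec.snd (α := ℕ) (β := (ℕ × List (ℕ × Bool)) × Bool))))
    have hv := Primrec.snd.comp (Primrec.fst.comp
      (Primrec.snd (α := ℕ) (β := (ℕ × List (ℕ × Bool)) × Bool)))
    refine Primrec.list_flatMap (Primrec.option_getD.comp Primrec.decode (Primrec.const []))
      (Primrec.ite (Primrec.eq.comp (Primrec.snd.comp Primrec.snd) (Primrec.const true)) ?_ ?_)
    · exact Primrec.list_append.comp ha (Primrec.list_append.comp hv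
        (Primrec.list_append.comp (primrec_invRev.comp ha) (primrec_invRev.comp hv)))
    · exact Primrec.list_append.comp hv (Primrec.list_append.comp ha
        (Primrec.list_append.comp (primrec_invRev.comp hv) (primrec_invRev.comp ha)))

-- Elements of the next term are products of commutators ⁅a, v⁆ and their inverses with `a` in the
-- previous term. A list entry records an index of `a`, a word for `v` and the sign; concatenating
-- lists multiplies.
open scoped commutatorElement in
theorem mem_lowerCentralSeries_iff_exists_word (p : ℕ) (u : FreeGroup ℕ) :
    u ∈ (⊤ : Subgroup (FreeGroup ℕ)).lowerCentralSeries p ↔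
      ∃ j, FreeGroup.mk (lowerCentralWord p j) = u := by
  induction p generalizing u with
  | zero =>
    refine ⟨fun _ => ⟨encode u.toWord, ?_⟩, fun _ => Subgroup.mem_top _⟩
    simp [lowerCentralWord, FreeGroup.mk_toWord]
  | succ p ih =>
    constructor
    · intro hu
      rw [Subgroup.mem_lowerCentralSeries_succ_iff] at hu
      suffices h : ∃ l : List ((ℕ × List (ℕ × Bool)) × Bool),
          FreeGroup.mk (lowerCentralWord (p + 1) (encode l)) = u from ⟨_, h.choose_spec⟩
      have happ : ∀ l m : List ((ℕ × List (ℕ × Bool)) × Bool),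
          lowerCentralWord (p + 1) (encode (l ++ m)) =
            lowerCentralWord (p + 1) (encode l) ++ lowerCentralWord (p + 1) (encode m) := by
        simp [lowerCentralWord]
      have hone : ∀ (a v : FreeGroup ℕ) (b : Bool),
          a ∈ (⊤ : Subgroup (FreeGroup ℕ)).lowerCentralSeries p →
          ∃ l : List ((ℕ × List (ℕ × Bool)) × Bool),
            FreeGroup.mk (lowerCentralWord (p + 1) (encode l)) = cond b ⁅a, v⁆ ⁅a, v⁆⁻¹ := by
        intro a v b ha
        obtain ⟨j, rfl⟩ := (ih a).1 ha
        refine ⟨[((j, v.toWord), b)], ?_⟩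
        cases b <;>
        simp [lowerCentralWord, ← FreeGroup.mul_mk, ← FreeGroup.inv_mk, FreeGroup.mk_toWord,
          commutatorElement_def, mul_assoc, -FreeGroup.invRev_length]
      induction hu using Subgroup.closure_induction'' with
      | one => exact ⟨[], by simp [lowerCentralWord, FreeGroup.one_eq_mk]⟩
      | mem x hx => obtain ⟨a, ha, v, -, rfl⟩ := hx; exact hone a v true ha
      | inv_mem x hx => obtain ⟨a, ha, v, -, rfl⟩ := hx; exact hone a v false ha
      | mul x y _ _ hx hy =>
        obtain ⟨l, rfl⟩ := hx
        obtain ⟨m, rfl⟩ := hy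
        exact ⟨l ++ m, by rw [happ, FreeGroup.mul_mk]⟩
    · rintro ⟨j, rfl⟩
      simp only [lowerCentralWord]
      induction (decode j : Option (List ((ℕ × List (ℕ × Bool)) × Bool))).getD [] with
      | nil => exact Subgroup.one_mem _
      | cons t l hl =>
        rw [List.flatMap_cons, ← FreeGroup.mul_mk]
        refine Subgroup.mul_mem _ ?_ hl
        have ha := (ih _).2 ⟨t.1.1, rfl⟩
        have h := Subgroup.commutator_mem_commutator ha (Subgroup.mem_top (FreeGroup.mk t.1.2))
        split
        · simpa [← FreeGroup.mul_mk, ← FreeGroup.inv_mk, commutatorElement_def, mul_assoc] using h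
        · simpa [← FreeGroup.mul_mk, ← FreeGroup.inv_mk, commutatorElement_def, mul_assoc]
            using Subgroup.inv_mem _ h

-- Computable conjunctions and disjunctions: complexity, truth and indices

namespace GroupLogic

/-- Membership of `x` is semidecided by searching for `n` with `c a n = x`. Currying the code of
this search makes its index primitive recursive in `a`. -/
theorem exists_ceSet_eq_range {σ : Type*} [Primcodable σ] {c : σ → ℕ → ℕ} (hc : Primrec₂ c) :
    ∃ g : σ → ℕ, Primrec g ∧ ∀ a, ceSet (g a) = Set.range (c a) := by
  let c' : ℕ → ℕ → ℕ := fun a n => ((decode a : Option σ).map fun s => c s n).getD 0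
  have hc' : Primrec₂ c' := Primrec.option_getD.comp
    (Primrec.option_map (Primrec.decode.comp Primrec.fst)
      (hc.comp Primrec.snd (Primrec.snd.comp Primrec.fst)).to₂) (Primrec.const 0)
  let P : ℕ →. ℕ := fun q => Nat.rfind fun n => Part.some (decide (c' q.unpair.1 n = q.unpair.2))
  have hP : Partrec P := by
    refine Partrec.rfind (Computable.partrec (Primrec.to_comp ?_))
    exact (Primrec.eq.comp (hc'.comp (Primrec.fst.comp (Primrec.unpair.comp Primrec.fst)) Primrec.snd)
      (Primrec.snd.comp (Primrec.unpair.comp Primrec.fst))).decide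
  obtain ⟨code, hcode⟩ := Nat.Partrec.Code.exists_code.1 (Partrec.nat_iff.1 hP)
  refine ⟨fun a => encode (code.curry (encode a)), Primrec.encode.comp
    (Nat.Partrec.Code.primrec₂_curry.comp (Primrec.const code) Primrec.encode), fun a => ?_⟩
  ext x
  simp only [ceSet, Set.mem_ofPred_eq, Denumerable.ofNat_encode, Nat.Partrec.Code.eval_curry, hcode, P,
    c', Nat.unpair_pair, encodek, Option.map_some, Option.getD_some, Set.mem_range]
  refine Nat.rfind_dom.trans ⟨fun ⟨n, hn, _⟩ => ⟨n, by simpa using hn⟩, fun ⟨n, hn⟩ => ⟨n, ?_, ?_⟩⟩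
  · simpa using hn
  · simp

end GroupLogic

namespace GroupLogic

namespace Formula

/-- A true formula. -/
def top {n : ℕ} : Formula n := .eq .one .one

/-- A false formula. -/
def bot {n : ℕ} : Formula n := .neg top

theorem isOpen_top {n : ℕ} : IsOpen (top : Formula n) := .eq _ _

theorem isOpen_bot {n : ℕ} : IsOpen (bot : Formula n) := .neg isOpen_top

/-- Extension to `ℕ` of a family of quantified formulas that is indexed by an encodable type. -/
def extendFamily {ι : Type*} [Encodable ι] {n : ℕ} (d : Formula n) (fam : ι → Σ k, Formula (n + k))
    (i : ℕ) : Σ k, Formula (n + k) :=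
  (decode i).elim ⟨0, d⟩ fam

/-- Numbers that code nothing contribute the padding formula `d`, so only `hd` is needed for them.
-/
theorem forall_extendFamily {ι : Type*} [Encodable ι] {n : ℕ} {d : Formula n}
    {fam : ι → Σ k, Formula (n + k)} {C : (Σ k, Formula (n + k)) → Prop} (hd : C ⟨0, d⟩) :
    (∀ i, C (extendFamily d fam i)) ↔ ∀ x, C (fam x) := by
  constructor
  · intro h x
    simpa [extendFamily] using h (encode x)
  · intro h i
    unfold extendFamily
    cases (decode i : Option ι) with
    | none => exact hd
    | some x => exact h x

/-- The conjunction of a family of universal formulas. -/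
def conj {ι : Type*} [Encodable ι] {n : ℕ} (fam : ι → Σ k, Formula (n + k)) : Formula n :=
  .iAnd Set.univ fun i => alls (extendFamily top fam i).1 (extendFamily top fam i).2

/-- The disjunction of a family of existential formulas. -/
def disj {ι : Type*} [Encodable ι] {n : ℕ} (fam : ι → Σ k, Formula (n + k)) : Formula n :=
  .iOr Set.univ fun i => exs (extendFamily bot fam i).1 (extendFamily bot fam i).2

theorem isPi_conj {ι : Type*} [Encodable ι] {n α : ℕ} (hα : 0 < α) {fam : ι → Σ k, Formula (n + k)}
    (h : ∀ x, ∃ β < α, IsSigma β (fam x).2) : IsPi α (conj fam) := by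
  have h' := (forall_extendFamily (C := fun q => ∃ β < α, IsSigma β q.2) (d := top)
    ⟨0, hα, .zero isOpen_top⟩).2 h
  choose β hβ hs using h'
  exact .pos hα Set.univ (fun i => (extendFamily top fam i).1) (fun i => β i)
    (fun i => (extendFamily top fam i).2) (fun i => hβ i) fun i => hs i

theorem isSigma_disj {ι : Type*} [Encodable ι] {n α : ℕ} (hα : 0 < α)
    {fam : ι → Σ k, Formula (n + k)} (h : ∀ x, ∃ β < α, IsPi β (fam x).2) : IsSigma α (disj fam) := by
  have h' := (forall_extendFamily (C := fun q => ∃ β < α, IsPi β q.2) (d := bot)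
    ⟨0, hα, .zero isOpen_bot⟩).2 h
  choose β hβ hs using h'
  exact .pos hα Set.univ (fun i => (extendFamily bot fam i).1) (fun i => β i)
    (fun i => (extendFamily bot fam i).2) (fun i => hβ i) fun i => hs i

/-- Assignments are treated as restrictions of infinite sequences, which avoids casts between the
types `Fin (n + k)`: binding a variable becomes an update. -/
theorem snoc_restrict {M : Type*} {n : ℕ} (f : ℕ → M) (a : M) :
    (Fin.snoc (fun i : Fin n => f i) a : Fin (n + 1) → M) =
      fun i : Fin (n + 1) => Function.update f n a i := by
  funext i
  refine Fin.lastCases ?_ (fun i => ?_) i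
  · simp
  · simp [Function.update_of_ne i.2.ne]

section Realize

variable {M : Type*} [Mul M] [Inv M] [One M]

theorem realize_alls {n : ℕ} (k : ℕ) (φ : Formula (n + k)) (f : ℕ → M) :
    (alls k φ).Realize (fun i : Fin n => f i) ↔
      ∀ g : ℕ → M, (∀ i < n, g i = f i) → φ.Realize (fun i : Fin (n + k) => g i) := by
  induction k with
  | zero =>
    refine ⟨fun h g hg => ?_, fun h => h f fun _ _ => rfl⟩
    have : (fun i : Fin n => f i) = fun i : Fin n => g i := funext fun i => (hg i i.2).symm
    rw [this] at h
    exact h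
  | succ k ih =>
    rw [alls, ih]
    refine ⟨fun h g hg => ?_, fun h g hg a => ?_⟩
    · have := h g hg (g (n + k))
      rw [snoc_restrict, Function.update_eq_self] at this
      exact this
    · rw [snoc_restrict]
      exact h (Function.update g (n + k) a) fun i hi => by
        rw [Function.update_of_ne (by omega), hg i hi]

theorem realize_exs {n : ℕ} (k : ℕ) (φ : Formula (n + k)) (f : ℕ → M) :
    (exs k φ).Realize (fun i : Fin n => f i) ↔
      ∃ g : ℕ → M, (∀ i < n, g i = f i) ∧ φ.Realize (fun i : Fin (n + k) => g i) := by
  induction k with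
  | zero =>
    refine ⟨fun h => ⟨f, fun _ _ => rfl, h⟩, fun ⟨g, hg, h⟩ => ?_⟩
    have : (fun i : Fin n => g i) = fun i : Fin n => f i := funext fun i => hg i i.2
    rw [← this]
    exact h
  | succ k ih =>
    rw [exs, ih]
    constructor
    · rintro ⟨g, hg, a, h⟩
      refine ⟨Function.update g (n + k) a, fun i hi => ?_, ?_⟩
      · rw [Function.update_of_ne (by omega), hg i hi]
      · rw [snoc_restrict] at h
        exact h
    · rintro ⟨g, hg, h⟩
      refine ⟨g, hg, g (n + k), ?_⟩
      rw [snoc_restrict, Function.update_eq_self]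
      exact h

theorem realize_conj {ι : Type*} [Encodable ι] {n : ℕ} {fam : ι → Σ k, Formula (n + k)}
    {f : ℕ → M} : (conj fam).Realize (fun i : Fin n => f i) ↔
      ∀ x, ∀ g : ℕ → M, (∀ i < n, g i = f i) →
        (fam x).2.Realize (fun i : Fin (n + (fam x).1) => g i) := by
  simp only [← realize_alls]
  rw [conj, Realize, Subtype.forall]
  simpa using forall_extendFamily (d := top) (fam := fam)
    (C := fun q => (alls q.1 q.2).Realize (fun i : Fin n => f i)) rfl

theorem realize_disj {ι : Type*} [Encodable ι] {n : ℕ} {fam : ι → Σ k, Formula (n + k)}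
    {f : ℕ → M} : (disj fam).Realize (fun i : Fin n => f i) ↔
      ∃ x, ∃ g : ℕ → M, (∀ i < n, g i = f i) ∧
        (fam x).2.Realize (fun i : Fin (n + (fam x).1) => g i) := by
  simp only [← realize_exs]
  rw [← not_iff_not, disj, Realize, Subtype.exists]
  simpa using forall_extendFamily (d := bot) (fam := fam)
    (C := fun q => ¬ (exs q.1 q.2).Realize (fun i : Fin n => f i)) fun h => h rfl

end Realize

section Index

theorem hasIndex_alls {n : ℕ} (k : ℕ) {φ : Formula (n + k)} {c : ℕ} (h : φ.HasIndex c) :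
    (alls k φ).HasIndex ((Nat.pair 4)^[k] c) := by
  induction k generalizing c with
  | zero => exact h
  | succ k ih => exact ih (φ := .all φ) ⟨c, h, rfl⟩

theorem hasIndex_exs {n : ℕ} (k : ℕ) {φ : Formula (n + k)} {c : ℕ} (h : φ.HasIndex c) :
    (exs k φ).HasIndex ((Nat.pair 5)^[k] c) := by
  induction k generalizing c with
  | zero => exact h
  | succ k ih => exact ih (φ := .ex φ) ⟨c, h, rfl⟩

/-- The Gödel number of `top`. -/
def topIndex : ℕ := Nat.pair 0 (Nat.pair (Nat.pair 1 0) (Nat.pair 1 0))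

/-- The Gödel number of `bot`. -/
def botIndex : ℕ := Nat.pair 1 topIndex

theorem hasIndex_top {n : ℕ} : (top : Formula n).HasIndex topIndex := rfl

theorem hasIndex_bot {n : ℕ} : (bot : Formula n).HasIndex botIndex := ⟨_, hasIndex_top, rfl⟩

variable {σ ι : Type*} [Primcodable σ] [Primcodable ι]

/-- Extension to `ℕ` of the indices of a family of quantified formulas. -/
theorem exists_extendFamily_index (q d : ℕ) {n : σ → ℕ} {fam : ∀ a, ι → Σ k, Formula (n a + k)}
    {c : σ → ι → ℕ} (hk : Primrec₂ fun a x => (fam a x).1) (hc : Primrec₂ c)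
    (h : ∀ a x, (fam a x).2.HasIndex (c a x)) {D : ∀ a, Formula (n a)}
    (hD : ∀ a, (D a).HasIndex d) :
    ∃ g : σ → ℕ, Primrec g ∧ ∃ e : σ → ℕ → ℕ, (∀ a, ceSet (g a) = Set.range fun i =>
        (Nat.pair q)^[(extendFamily (D a) (fam a) i).1] (e a i)) ∧
      ∀ a i, (extendFamily (D a) (fam a) i).2.HasIndex (e a i) := by
  have hg : Primrec₂ fun (a : σ) (i : ℕ) => (decode i : Option ι).elim d
      fun x => (Nat.pair q)^[(fam a x).1] (c a x) := by
    refine (Primrec.option_casesOn (o := fun y : σ × ℕ => (decode y.2 : Option ι))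
      (f := fun _ => d) (g := fun y x => (Nat.pair q)^[(fam y.1 x).1] (c y.1 x))
      (Primrec.decode.comp Primrec.snd) (Primrec.const d) ?_).of_eq fun y => ?_
    · exact Primrec.nat_iterate (hk.comp (Primrec.fst.comp Primrec.fst) Primrec.snd)
        (hc.comp (Primrec.fst.comp Primrec.fst) Primrec.snd)
        (Primrec₂.natPair.comp (Primrec.const q) Primrec.snd).to₂
    · generalize hx : (decode y.2 : Option ι) = x
      cases x <;> simp [hx]
  obtain ⟨g, hg, hgr⟩ := exists_ceSet_eq_range hg
  refine ⟨g, hg, fun a i => (decode i : Option ι).elim d (c a), fun a => ?_, fun a i => ?_⟩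
  · rw [hgr]
    congr 1
    funext i
    dsimp only [extendFamily]
    cases (decode i : Option ι) <;> rfl
  · dsimp only [extendFamily]
    cases (decode i : Option ι) with
    | none => exact hD a
    | some x => exact h a x

theorem exists_hasIndex_conj {n : σ → ℕ} {fam : ∀ a, ι → Σ k, Formula (n a + k)}
    {c : σ → ι → ℕ} (hk : Primrec₂ fun a x => (fam a x).1) (hc : Primrec₂ c)
    (h : ∀ a x, (fam a x).2.HasIndex (c a x)) :
    ∃ g : σ → ℕ, Primrec g ∧ ∀ a, (conj (fam a)).HasIndex (g a) := by
  obtain ⟨g, hg, e, hge, he⟩ := exists_extendFamily_index 4 topIndex hk hc h fun _ => hasIndex_top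
  refine ⟨fun a => Nat.pair 6 (g a), Primrec₂.natPair.comp (Primrec.const 6) hg, fun a =>
    ⟨g a, rfl, fun i => ⟨_, ?_, hasIndex_alls _ (he a i)⟩, ?_⟩⟩
  · rw [hge]
    exact ⟨i, rfl⟩
  · rw [hge]
    rintro _ ⟨i, rfl⟩
    exact ⟨⟨i, trivial⟩, hasIndex_alls _ (he a i)⟩

theorem exists_hasIndex_disj {n : σ → ℕ} {fam : ∀ a, ι → Σ k, Formula (n a + k)}
    {c : σ → ι → ℕ} (hk : Primrec₂ fun a x => (fam a x).1) (hc : Primrec₂ c)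
    (h : ∀ a x, (fam a x).2.HasIndex (c a x)) :
    ∃ g : σ → ℕ, Primrec g ∧ ∀ a, (disj (fam a)).HasIndex (g a) := by
  obtain ⟨g, hg, e, hge, he⟩ := exists_extendFamily_index 5 botIndex hk hc h fun _ => hasIndex_bot
  refine ⟨fun a => Nat.pair 7 (g a), Primrec₂.natPair.comp (Primrec.const 7) hg, fun a =>
    ⟨g a, rfl, fun i => ⟨_, ?_, hasIndex_exs _ (he a i)⟩, ?_⟩⟩
  · rw [hge]
    exact ⟨i, rfl⟩
  · rw [hge]
    rintro _ ⟨i, rfl⟩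
    exact ⟨⟨i, trivial⟩, hasIndex_exs _ (he a i)⟩

end Index

section Isomorphism

variable {M N : Type*} [Mul M] [Inv M] [One M] [Mul N] [Inv N] [One N]

theorem _root_.GroupLogic.Term.value_map (e : M ≃* N) (h1 : e 1 = 1) (hinv : ∀ x, e x⁻¹ = (e x)⁻¹)
    {n : ℕ} (t : Term n) (v : Fin n → M) : t.value (fun i => e (v i)) = e (t.value v) := by
  induction t with
  | var i => rfl
  | one => exact h1.symm
  | mul s t hs ht => simp only [Term.value, hs, ht, map_mul]
  | inv t ht => simp only [Term.value, ht, hinv]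

theorem realize_map (e : M ≃* N) (h1 : e 1 = 1) (hinv : ∀ x, e x⁻¹ = (e x)⁻¹) {n : ℕ}
    (φ : Formula n) (v : Fin n → M) : φ.Realize (fun i => e (v i)) ↔ φ.Realize v := by
  have hsnoc : ∀ {n : ℕ} (v : Fin n → M) (a : M),
      (Fin.snoc (fun i => e (v i)) (e a) : Fin (n + 1) → N) =
        fun i => e ((Fin.snoc v a : Fin (n + 1) → M) i) := fun v a => by
    funext i
    refine Fin.lastCases ?_ (fun i => ?_) i <;> simp
  induction φ with
  | eq s t => simp only [Realize, Term.value_map e h1 hinv, e.injective.eq_iff]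
  | neg φ ih => simp only [Realize, ih]
  | and φ ψ ih ih' => simp only [Realize, ih, ih']
  | or φ ψ ih ih' => simp only [Realize, ih, ih']
  | all φ ih => simp only [Realize, e.surjective.forall, hsnoc, ih]
  | ex φ ih => simp only [Realize, e.surjective.exists, hsnoc, ih]
  | iAnd s f ih => simp only [Realize, ih]
  | iOr s f ih => simp only [Realize, ih]

end Isomorphism

end Formula

end GroupLogic

-- Words as terms

/-- Gives truncation a primitive recursive form on lists of letters. -/
theorem freeGroup_mk_filter_lt (n : ℕ) (w : List (ℕ × Bool)) :
    FreeGroup.mk (w.filter fun x => x.1 < n) =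
      FreeGroup.lift (truncate n FreeGroup.of) (FreeGroup.mk w) := by
  induction w with
  | nil => rfl
  | cons x w ih =>
    rw [← List.singleton_append, ← FreeGroup.mul_mk, map_mul, ← ih, List.filter_append,
      ← FreeGroup.mul_mk]
    congr 1
    obtain ⟨i, b⟩ := x
    by_cases hi : i < n
    · cases b <;> simp [FreeGroup.lift_mk, truncate, hi, FreeGroup.of, FreeGroup.inv_mk, FreeGroup.invRev]
    · cases b <;> simp [FreeGroup.lift_mk, truncate, hi, FreeGroup.one_eq_mk]

theorem toAdd_exponents_mk (w : List (ℕ × Bool)) (i : ℕ) :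
    (exponents (FreeGroup.mk w)).toAdd i =
      (w.filter fun x => x = (i, true)).length - (w.filter fun x => x = (i, false)).length := by
  induction w with
  | nil => simp [← FreeGroup.one_eq_mk]
  | cons x w ih =>
    rw [← List.singleton_append, ← FreeGroup.mul_mk, map_mul, toAdd_mul, Finsupp.add_apply, ih]
    obtain ⟨j, b⟩ := x
    have h : (exponents (FreeGroup.mk [(j, b)])).toAdd i =
        if j = i then (if b then 1 else -1) else 0 := by
      cases b <;> simp [exponents, FreeGroup.lift_mk, Finsupp.single_apply, apply_ite Neg.neg]
    rw [h]
    by_cases hj : j = i <;> cases b <;> simp [hj] <;> ring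

namespace GroupLogic

/-- The term `x_i`, or `1` if there is no such variable. -/
def varTerm (N i : ℕ) : Term N := if h : i < N then .var ⟨i, h⟩ else .one

/-- The Gödel number of `varTerm N i`. -/
def varIndex (N i : ℕ) : ℕ := if i < N then Nat.pair 0 i else Nat.pair 1 0

theorem code_varTerm (N i : ℕ) : (varTerm N i).code = varIndex N i := by
  unfold varTerm varIndex
  split <;> rfl

/-- The term which evaluates a word, where the letter `i` stands for the variable `x_{i+1}`. -/
def wordTerm (N : ℕ) : List (ℕ × Bool) → Term N
  | [] => .one
  | x :: w => .mul (if x.2 then varTerm N (x.1 + 1) else .inv (varTerm N (x.1 + 1))) (wordTerm N w)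

/-- The Gödel number of `wordTerm N w`. -/
def wordIndex (N : ℕ) (w : List (ℕ × Bool)) : ℕ :=
  w.foldr (fun x c => Nat.pair 2 (Nat.pair
    (if x.2 then varIndex N (x.1 + 1) else Nat.pair 3 (varIndex N (x.1 + 1))) c)) (Nat.pair 1 0)

theorem code_wordTerm (N : ℕ) (w : List (ℕ × Bool)) : (wordTerm N w).code = wordIndex N w := by
  induction w with
  | nil => rfl
  | cons x w ih =>
    rw [wordTerm, Term.code, ih]
    obtain ⟨i, b⟩ := x
    cases b <;> simp [wordIndex, Term.code, code_varTerm]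

theorem primrec_varIndex : Primrec₂ varIndex :=
  Primrec.ite (Primrec.nat_lt.comp Primrec.snd Primrec.fst)
    (Primrec₂.natPair.comp (Primrec.const 0) Primrec.snd) (Primrec.const _)

theorem primrec_wordIndex : Primrec₂ wordIndex := by
  have hv : Primrec fun y : (ℕ × List (ℕ × Bool)) × (ℕ × Bool) × ℕ =>
      varIndex y.1.1 (y.2.1.1 + 1) :=
    primrec_varIndex.comp (Primrec.fst.comp Primrec.fst)
      (Primrec.succ.comp (Primrec.fst.comp (Primrec.fst.comp Primrec.snd)))
  refine Primrec.list_foldr (f := fun y : ℕ × List (ℕ × Bool) => y.2)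
    (h := fun y x => Nat.pair 2 (Nat.pair (if x.1.2 then varIndex y.1 (x.1.1 + 1) else
      Nat.pair 3 (varIndex y.1 (x.1.1 + 1))) x.2)) Primrec.snd (Primrec.const _) ?_
  exact Primrec₂.natPair.comp (Primrec.const 2) (Primrec₂.natPair.comp
    (Primrec.ite (Primrec.eq.comp (Primrec.snd.comp (Primrec.fst.comp Primrec.snd))
      (Primrec.const true)) hv (Primrec₂.natPair.comp (Primrec.const 3) hv))
    (Primrec.snd.comp Primrec.snd))

theorem value_varTerm {M : Type*} [Mul M] [Inv M] [One M] {N i : ℕ} (f : ℕ → M) (h : i < N) :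
    (varTerm N i).value (fun i : Fin N => f i) = f i := by
  simp [varTerm, h, Term.value]

/-- `varTerm` reads a letter without a variable as 1, just as `truncate` does. The bound is `N - 1`
because `x_0` is reserved for the element to be generated. -/
theorem value_wordTerm {G : Type*} [Group G] (N : ℕ) (w : List (ℕ × Bool)) (f : ℕ → G) :
    (wordTerm N w).value (fun i : Fin N => f i) =
      FreeGroup.lift (truncate (N - 1) fun i => f (i + 1)) (FreeGroup.mk w) := by
  have hv : ∀ i, (varTerm N (i + 1)).value (fun i : Fin N => f i) =
      truncate (N - 1) (fun i => f (i + 1)) i := fun i => by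
    by_cases h : i + 1 < N
    · simp [value_varTerm f h, truncate, Nat.lt_sub_of_add_lt h]
    · have : ¬ i < N - 1 := by omega
      simp [varTerm, h, truncate, this, Term.value]
  induction w with
  | nil => rfl
  | cons x w ih =>
    rw [wordTerm, Term.value, ih, ← List.singleton_append, ← FreeGroup.mul_mk, map_mul]
    congr 1
    obtain ⟨i, b⟩ := x
    cases b <;> simp [FreeGroup.lift_mk, Term.value, hv]

-- Relations that refute primitivity

/-- Data of a relation showing that a tuple is not primitive: the modulus, the position of the bad
exponent, the word in the tuple, the index of a word in the commutator subgroup, and the number of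
parameters. -/
abbrev RelationData : Type := (ℕ × ℕ) × List (ℕ × Bool) × ℕ × ℕ

namespace RelationData

/-- The exponent at the given position is not divisible by the modulus. -/
abbrev IsBad (n : ℕ) (t : RelationData) : Prop :=
  t.1.2 < n ∧ ¬ (t.2.1.filter fun x => x = (t.1.2, true)).length % t.1.1 =
    (t.2.1.filter fun x => x = (t.1.2, false)).length % t.1.1

/-- The word in the tuple. -/
def left (n : ℕ) (t : RelationData) : List (ℕ × Bool) := t.2.1.filter fun x => x.1 < n

/-- The product of a power and a product of commutators, in new letters. -/
def right (n : ℕ) (t : RelationData) : List (ℕ × Bool) :=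
  List.replicate t.1.1 (n, true) ++
    (lowerCentralWord 1 t.2.2.1).map fun x => (x.1 + (n + 1), x.2)

/-- Equal remainders of the two letter counts mean that the modulus divides the exponent. For
modulus 0, `% 0` is the identity, so the test is equality, as required. -/
theorem isBad_iff (n : ℕ) (t : RelationData) : t.IsBad n ↔
    t.1.2 < n ∧ ¬ (t.1.1 : ℤ) ∣ (exponents (FreeGroup.mk t.2.1)).toAdd t.1.2 := by
  rw [toAdd_exponents_mk, ← Nat.modEq_iff_dvd]
  exact and_congr_right fun _ => not_congr eq_comm

theorem lift_right {G : Type*} [Group G] (n : ℕ) (t : RelationData) (g : ℕ → G) :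
    FreeGroup.lift g (FreeGroup.mk (t.right n)) = g n ^ t.1.1 *
      FreeGroup.lift (fun i => g (i + (n + 1))) (FreeGroup.mk (lowerCentralWord 1 t.2.2.1)) := by
  rw [right, ← FreeGroup.mul_mk, map_mul]
  congr 1
  · simp [FreeGroup.lift_mk]
  · simp [FreeGroup.lift_mk, Function.comp_def]

theorem primrec_filter_eq (b : Bool) {σ : Type*} [Primcodable σ] {w : σ → List (ℕ × Bool)}
    {i : σ → ℕ} (hw : Primrec w) (hi : Primrec i) :
    Primrec fun a => ((w a).filter fun x => x = (i a, b)).length :=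
  Primrec.list_length.comp ((PrimrecRel.listFilter (R := fun x y : ℕ × Bool => x = y)
    Primrec.eq).comp hw (Primrec.pair hi (Primrec.const b)))

theorem primrec_filter_lt :
    Primrec₂ fun (w : List (ℕ × Bool)) (n : ℕ) => w.filter fun x => x.1 < n :=
  PrimrecRel.listFilter (R := fun (x : ℕ × Bool) (n : ℕ) => x.1 < n)
    (Primrec.nat_lt.comp (Primrec.fst.comp Primrec.fst) Primrec.snd)

theorem primrec_left : Primrec₂ left :=
  primrec_filter_lt.comp (Primrec.fst.comp (Primrec.snd.comp Primrec.snd)) Primrec.fst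

theorem primrec_right : Primrec₂ right := by
  refine Primrec.list_append.comp
    (Primrec.list_replicate.comp (Primrec.fst.comp (Primrec.fst.comp Primrec.snd))
      (Primrec.pair Primrec.fst (Primrec.const true)))
    (Primrec.list_map ((primrec_lowerCentralWord 1).comp
      (Primrec.fst.comp (Primrec.snd.comp (Primrec.snd.comp Primrec.snd)))) ?_)
  exact Primrec.pair (Primrec.nat_add.comp (Primrec.fst.comp Primrec.snd)
    (Primrec.succ.comp (Primrec.fst.comp Primrec.fst))) (Primrec.snd.comp Primrec.snd)

theorem primrecRel_isBad : PrimrecRel IsBad := by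
  have hi : Primrec fun y : ℕ × RelationData => y.2.1.2 :=
    Primrec.snd.comp (Primrec.fst.comp Primrec.snd)
  have hd : Primrec fun y : ℕ × RelationData => y.2.1.1 :=
    Primrec.fst.comp (Primrec.fst.comp Primrec.snd)
  have hw : Primrec fun y : ℕ × RelationData => y.2.2.1 :=
    Primrec.fst.comp (Primrec.snd.comp Primrec.snd)
  exact PrimrecPred.and (Primrec.nat_lt.comp hi Primrec.fst)
    (PrimrecPred.not (Primrec.eq.comp (Primrec.nat_mod.comp (primrec_filter_eq true hw hi) hd)
      (Primrec.nat_mod.comp (primrec_filter_eq false hw hi) hd)))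

end RelationData

namespace Formula

/-- The formula which says that the variables `x_1, …, x_{N-1}` and the new variables satisfy a
relation which is impossible for primitive tuples. -/
def relation (N : ℕ) (t : RelationData) : Σ k, Formula (N + k) :=
  ⟨t.2.2.2, if t.IsBad (N - 1) then
    .eq (wordTerm _ (t.left (N - 1))) (wordTerm _ (t.right (N - 1))) else bot⟩

/-- The Gödel number of `relation N t`. -/
def relationIndex (N : ℕ) (t : RelationData) : ℕ :=
  if t.IsBad (N - 1) then
    Nat.pair 0 (Nat.pair (wordIndex (N + t.2.2.2) (t.left (N - 1)))
      (wordIndex (N + t.2.2.2) (t.right (N - 1)))) else botIndex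

theorem isOpen_relation (N : ℕ) (t : RelationData) : IsOpen (relation N t).2 := by
  unfold relation
  dsimp only
  split
  · exact .eq _ _
  · exact isOpen_bot

theorem hasIndex_relation (N : ℕ) (t : RelationData) :
    (relation N t).2.HasIndex (relationIndex N t) := by
  unfold relation relationIndex
  dsimp only
  split
  · rw [HasIndex, code_wordTerm, code_wordTerm]
  · exact hasIndex_bot

theorem primrec_relation_fst {σ ι : Type*} [Primcodable σ] [Primcodable ι] {N : σ → ℕ}
    {t : σ → ι → RelationData} (ht : Primrec₂ t) : Primrec₂ fun a x => (relation (N a) (t a x)).1 :=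
  (Primrec.snd.comp (Primrec.snd.comp Primrec.snd)).comp ht

theorem primrec_relationIndex : Primrec₂ relationIndex := by
  have hN : Primrec fun y : ℕ × RelationData => y.1 - 1 := Primrec.pred.comp Primrec.fst
  have hM : Primrec fun y : ℕ × RelationData => y.1 + y.2.2.2.2 :=
    Primrec.nat_add.comp Primrec.fst
      (Primrec.snd.comp (Primrec.snd.comp (Primrec.snd.comp Primrec.snd)))
  exact Primrec.ite (RelationData.primrecRel_isBad.comp hN Primrec.snd)
    (Primrec₂.natPair.comp (Primrec.const 0) (Primrec₂.natPair.comp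
      (primrec_wordIndex.comp hM (RelationData.primrec_left.comp hN Primrec.snd))
      (primrec_wordIndex.comp hM (RelationData.primrec_right.comp hN Primrec.snd))))
    (Primrec.const _)

/-- Commutator words take values in the commutator subgroup. Conversely, an enumeration of `G`
writes any element of that subgroup as the value of an enumerated commutator word with finitely many
parameters. -/
theorem exists_realize_relation {G : Type*} [Group G] [Countable G] {N : ℕ} (hN : 0 < N)
    (f : ℕ → G) :
    (∃ t, ∃ g : ℕ → G, (∀ i < N, g i = f i) ∧
      (relation N t).2.Realize (fun i : Fin (N + (relation N t).1) => g i)) ↔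
      ¬ IsPrimitiveTuple (N - 1) fun i => f (i + 1) := by
  have hleft : ∀ (t : RelationData) (g : ℕ → G), (∀ i < N, g i = f i) →
      (wordTerm (N + t.2.2.2) (t.left (N - 1))).value (fun i : Fin (N + t.2.2.2) => g i) =
        FreeGroup.lift (truncate (N - 1) fun i => f (i + 1)) (FreeGroup.mk t.2.1) := by
    intro t g hg
    rw [value_wordTerm, RelationData.left, freeGroup_mk_filter_lt, ← lift_truncate]
    rw [truncate_congr (g := fun i => f (i + 1))]
    intro i hi
    rw [truncate, if_pos (by omega), hg _ (by omega)]
  constructor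
  · rintro ⟨t, g, hg, h⟩ hp
    unfold relation at h
    dsimp only at h
    split at h
    · rename_i hb
      rw [RelationData.isBad_iff] at hb
      rw [Realize, hleft t g hg, value_wordTerm, RelationData.lift_right] at h
      refine hb.2 (hp _ _ _ _ ?_ h _ hb.1)
      have hc : FreeGroup.mk (lowerCentralWord 1 t.2.2.1) ∈ commutator (FreeGroup ℕ) :=
        (mem_lowerCentralSeries_iff_exists_word 1 _).2 ⟨_, rfl⟩
      have := Subgroup.mem_map_of_mem
        (FreeGroup.lift fun i => truncate (N + t.2.2.2 - 1) (fun i => g (i + 1)) (i + (N - 1 + 1))) hc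
      rw [commutator_def, Subgroup.map_commutator] at this
      exact Subgroup.commutator_mono le_top le_top this
    · exact h rfl
  · intro hp
    unfold IsPrimitiveTuple at hp
    push Not at hp
    obtain ⟨d, u, z, c, hc, h, i, hi, hdvd⟩ := hp
    obtain ⟨e, he⟩ := exists_surjective_nat G
    have hes : Function.Surjective (FreeGroup.lift e) := fun x => by
      obtain ⟨k, rfl⟩ := he x
      exact ⟨FreeGroup.of k, FreeGroup.lift_apply_of⟩
    rw [commutator_def, ← Subgroup.map_top_of_surjective _ hes, ← Subgroup.map_commutator] at hc
    obtain ⟨c, hc, rfl⟩ := hc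
    obtain ⟨j, rfl⟩ := (mem_lowerCentralSeries_iff_exists_word 1 c).1 hc
    obtain ⟨m, hm⟩ := exists_lift_truncate_eq (FreeGroup.mk (lowerCentralWord 1 j))
    -- `x_N` holds `z`, and the variables from `x_{N+1}` on hold `e 0`, `e 1`, …, of which `m` are
    -- needed; hence `m + 1` new variables.
    let g : ℕ → G := fun i => if i < N then f i else if i = N then z else e (i - (N + 1))
    have hg : ∀ i < N, g i = f i := fun i hi => if_pos hi
    refine ⟨((d, i), u.toWord, j, m + 1), g, hg, ?_⟩
    unfold relation
    dsimp only
    rw [if_pos ((RelationData.isBad_iff _ _).2 ⟨hi, by rwa [FreeGroup.mk_toWord]⟩), Realize,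
      hleft ((d, i), u.toWord, j, m + 1) g hg, value_wordTerm, RelationData.lift_right]
    dsimp only
    rw [FreeGroup.mk_toWord, h]
    have e1 : truncate (N + (m + 1) - 1) (fun i => g (i + 1)) (N - 1) = z := by
      rw [truncate, if_pos (by omega), Nat.sub_add_cancel hN]
      simp [g]
    have e2 : (fun i => truncate (N + (m + 1) - 1) (fun i => g (i + 1)) (i + (N - 1 + 1))) =
        truncate m e := by
      funext i
      by_cases hi : i < m
      · rw [truncate, truncate, if_pos hi, if_pos (by omega)]
        simp only [g]
        rw [if_neg (by omega), if_neg (by omega)]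
        congr 1
        omega
      · rw [truncate, truncate, if_neg hi, if_neg (by omega)]
    rw [e1, e2, lift_truncate, hm m le_rfl]

end Formula

end GroupLogic

-- The axioms and the Scott sentence

namespace GroupLogic

namespace Formula

/-- The formula which says that if `x_1, …, x_{N-1}` is primitive and satisfies the relation `w`, then `w`
lies in the lower central series of the free group. -/
def freeness (p N : ℕ) (w : List (ℕ × Bool)) : Formula N :=
  disj (ι := RelationData ⊕ ℕ) (Sum.elim (relation N) fun j => ⟨0,
    if FreeGroup.reduce ((w.filter fun x => x.1 < N - 1) ++
      FreeGroup.invRev (lowerCentralWord p j)) = [] then top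
    else .neg (.eq (wordTerm N w) .one)⟩)

theorem isSigma_freeness (p N : ℕ) (w : List (ℕ × Bool)) : IsSigma 1 (freeness p N w) := by
  refine isSigma_disj one_pos fun x => ⟨0, one_pos, .zero ?_⟩
  rcases x with t | j
  · exact isOpen_relation N t
  · dsimp only [Sum.elim_inr]
    split
    · exact isOpen_top
    · exact .neg (.eq _ _)

theorem exists_hasIndex_freeness (p : ℕ) :
    ∃ g : ℕ × List (ℕ × Bool) → ℕ, Primrec g ∧ ∀ a, (freeness p a.1 a.2).HasIndex (g a) := by
  refine exists_hasIndex_disj (n := fun a : ℕ × List (ℕ × Bool) => a.1)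
    (c := fun a x => Sum.casesOn x (relationIndex a.1) fun j =>
      if FreeGroup.reduce ((a.2.filter fun x => x.1 < a.1 - 1) ++
        FreeGroup.invRev (lowerCentralWord p j)) = [] then topIndex
      else Nat.pair 1 (Nat.pair 0 (Nat.pair (wordIndex a.1 a.2) (Nat.pair 1 0)))) ?_ ?_ ?_
  · refine (Primrec.sumCasesOn (f := fun y : (ℕ × List (ℕ × Bool)) × (RelationData ⊕ ℕ) => y.2)
      (g := fun y t => (relation y.1.1 t).1) (h := fun _ _ => 0) Primrec.snd
      (primrec_relation_fst Primrec₂.right) (Primrec.const 0).to₂).of_eq fun y => ?_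
    obtain ⟨a, t | j⟩ := y <;> rfl
  · refine Primrec.sumCasesOn (f := fun y : (ℕ × List (ℕ × Bool)) × (RelationData ⊕ ℕ) => y.2)
      (g := fun y t => relationIndex y.1.1 t) (h := fun y j =>
      if FreeGroup.reduce ((y.1.2.filter fun x => x.1 < y.1.1 - 1) ++
        FreeGroup.invRev (lowerCentralWord p j)) = [] then topIndex
      else Nat.pair 1 (Nat.pair 0 (Nat.pair (wordIndex y.1.1 y.1.2) (Nat.pair 1 0)))) Primrec.snd
      (primrec_relationIndex.comp (Primrec.fst.comp (Primrec.fst.comp Primrec.fst)) Primrec.snd) ?_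
    have hw : Primrec fun z : ((ℕ × List (ℕ × Bool)) × (RelationData ⊕ ℕ)) × ℕ => z.1.1.2 :=
      Primrec.snd.comp (Primrec.fst.comp Primrec.fst)
    have hN : Primrec fun z : ((ℕ × List (ℕ × Bool)) × (RelationData ⊕ ℕ)) × ℕ => z.1.1.1 :=
      Primrec.fst.comp (Primrec.fst.comp Primrec.fst)
    exact Primrec.ite (Primrec.eq.comp (primrec_reduce.comp (Primrec.list_append.comp
        (RelationData.primrec_filter_lt.comp hw (Primrec.pred.comp hN))
        (primrec_invRev.comp ((primrec_lowerCentralWord p).comp Primrec.snd)))) (Primrec.const []))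
      (Primrec.const _) (Primrec₂.natPair.comp (Primrec.const 1) (Primrec₂.natPair.comp
        (Primrec.const 0) (Primrec₂.natPair.comp (primrec_wordIndex.comp hN hw) (Primrec.const _))))
  · rintro a (t | j)
    · exact hasIndex_relation _ t
    · dsimp only [Sum.elim_inr]
      split
      · exact hasIndex_top
      · exact ⟨_, by rw [← code_wordTerm]; rfl, rfl⟩

/-- Membership in the lower central series is searched for, not decided: the disjunct for `j` is
true outright if the `j`-th enumerated word equals the truncated `w` in the free group, and
otherwise says `w ≠ 1`. If no `j` matches, only `w ≠ 1` or a failure of primitivity remains. -/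
theorem realize_freeness {G : Type*} [Group G] [Countable G] (p : ℕ) {N : ℕ} (hN : 0 < N)
    (w : List (ℕ × Bool)) (f : ℕ → G) : (freeness p N w).Realize (fun i : Fin N => f i) ↔
      (IsPrimitiveTuple (N - 1) (fun i => f (i + 1)) →
        FreeGroup.lift (truncate (N - 1) fun i => f (i + 1)) (FreeGroup.mk w) = 1 →
        FreeGroup.lift (truncate (N - 1) FreeGroup.of) (FreeGroup.mk w) ∈
          (⊤ : Subgroup (FreeGroup ℕ)).lowerCentralSeries p) := by
  rw [freeness, realize_disj, Sum.exists]
  simp only [Sum.elim_inl, Sum.elim_inr]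
  rw [exists_realize_relation hN, imp_iff_not_or]
  refine or_congr_right ?_
  have hred : ∀ j, FreeGroup.reduce ((w.filter fun x => x.1 < N - 1) ++
      FreeGroup.invRev (lowerCentralWord p j)) = [] ↔
      FreeGroup.mk (lowerCentralWord p j) =
        FreeGroup.lift (truncate (N - 1) FreeGroup.of) (FreeGroup.mk w) := by
    intro j
    rw [← freeGroup_mk_filter_lt, eq_comm (a := FreeGroup.mk _),
      ← mul_inv_eq_one (a := FreeGroup.mk _), FreeGroup.inv_mk, FreeGroup.mul_mk, ← FreeGroup.toWord_eq_nil_iff, FreeGroup.toWord_mk]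
  have hne : ∀ g : ℕ → G, (∀ i < N, g i = f i) →
      ((Formula.neg (.eq (wordTerm N w) .one)).Realize (fun i : Fin N => g i) ↔
        ¬ FreeGroup.lift (truncate (N - 1) fun i => f (i + 1)) (FreeGroup.mk w) = 1) := by
    intro g hg
    have : (fun i : Fin N => g i) = fun i : Fin N => f i := funext fun i => hg i i.2
    rw [this, Realize, Realize, value_wordTerm]
    rfl
  constructor
  · rintro ⟨j, g, hg, h⟩ hw
    split at h
    · rename_i hj
      exact (mem_lowerCentralSeries_iff_exists_word p _).2 ⟨j, (hred j).1 hj⟩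
    · exact absurd hw ((hne g hg).1 h)
  · intro h
    by_cases hw : FreeGroup.lift (truncate (N - 1) fun i => f (i + 1)) (FreeGroup.mk w) = 1
    · obtain ⟨j, hj⟩ := (mem_lowerCentralSeries_iff_exists_word p _).1 (h hw)
      refine ⟨j, f, fun _ _ => rfl, ?_⟩
      rw [if_pos ((hred j).2 hj)]
      rfl
    · refine ⟨0, f, fun _ _ => rfl, ?_⟩
      split
      · rfl
      · exact (hne f fun _ _ => rfl).2 hw

/-- The formula which says that `x_1, …, x_{N-1}` is primitive and `x_0` is the value of the word `w`. -/
def generation (N : ℕ) (w : List (ℕ × Bool)) : Formula N :=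
  conj (ι := Option RelationData) fun o => o.elim ⟨0, .eq (varTerm N 0) (wordTerm N w)⟩
    fun t => ⟨(relation N t).1, .neg (relation N t).2⟩

theorem isPi_generation (N : ℕ) (w : List (ℕ × Bool)) : IsPi 1 (generation N w) := by
  refine isPi_conj one_pos fun x => ⟨0, one_pos, .zero ?_⟩
  rcases x with _ | t
  · exact .eq _ _
  · exact .neg (isOpen_relation N t)

theorem exists_hasIndex_generation :
    ∃ g : ℕ × List (ℕ × Bool) → ℕ, Primrec g ∧ ∀ a, (generation a.1 a.2).HasIndex (g a) := by
  refine exists_hasIndex_conj (n := fun a : ℕ × List (ℕ × Bool) => a.1)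
    (c := fun a x => Option.casesOn x
      (Nat.pair 0 (Nat.pair (varIndex a.1 0) (wordIndex a.1 a.2)))
      fun t => Nat.pair 1 (relationIndex a.1 t)) ?_ ?_ ?_
  · refine (Primrec.option_casesOn (o := fun y : (ℕ × List (ℕ × Bool)) × Option RelationData => y.2)
      (f := fun _ => 0) (g := fun y t => (relation y.1.1 t).1) Primrec.snd (Primrec.const 0)
      (primrec_relation_fst Primrec₂.right)).of_eq fun y => ?_
    obtain ⟨a, _ | t⟩ := y <;> rfl
  · exact Primrec.option_casesOn (o := fun y : (ℕ × List (ℕ × Bool)) × Option RelationData => y.2)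
      (f := fun y => Nat.pair 0 (Nat.pair (varIndex y.1.1 0) (wordIndex y.1.1 y.1.2)))
      (g := fun y t => Nat.pair 1 (relationIndex y.1.1 t)) Primrec.snd
      (Primrec₂.natPair.comp (Primrec.const 0) (Primrec₂.natPair.comp
        (primrec_varIndex.comp (Primrec.fst.comp Primrec.fst) (Primrec.const 0))
        (primrec_wordIndex.comp (Primrec.fst.comp Primrec.fst) (Primrec.snd.comp Primrec.fst))))
      (Primrec₂.natPair.comp (Primrec.const 1)
        (primrec_relationIndex.comp (Primrec.fst.comp (Primrec.fst.comp Primrec.fst)) Primrec.snd))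
  · rintro a (_ | t)
    · dsimp only [Option.elim_none]
      rw [← code_varTerm, ← code_wordTerm]
      rfl
    · exact ⟨_, hasIndex_relation _ t, rfl⟩

theorem realize_generation {G : Type*} [Group G] [Countable G] {N : ℕ} (hN : 0 < N)
    (w : List (ℕ × Bool)) (f : ℕ → G) : (generation N w).Realize (fun i : Fin N => f i) ↔
      IsPrimitiveTuple (N - 1) (fun i => f (i + 1)) ∧
        f 0 = FreeGroup.lift (truncate (N - 1) fun i => f (i + 1)) (FreeGroup.mk w) := by
  rw [generation, realize_conj, Option.forall, and_comm]
  refine and_congr ?_ ?_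
  · rw [← not_iff_not, ← exists_realize_relation hN]
    push Not
    simp only [Option.elim_some, Realize, not_not]
  · have : ∀ g : ℕ → G, (∀ i < N, g i = f i) →
        ((Formula.eq (varTerm N 0) (wordTerm N w)).Realize (fun i : Fin N => g i) ↔
          f 0 = FreeGroup.lift (truncate (N - 1) fun i => f (i + 1)) (FreeGroup.mk w)) := by
      intro g hg
      have : (fun i : Fin N => g i) = fun i : Fin N => f i := funext fun i => hg i i.2
      rw [this, Realize, value_varTerm f hN, value_wordTerm]
    exact ⟨fun h => (this f fun _ _ => rfl).1 (h f fun _ _ => rfl), fun h g hg => (this g hg).2 h⟩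

/-- The formula which says that if `x_1, …, x_{N-1}` is primitive, then it extends to a primitive tuple
which generates a subgroup containing `x_0`. -/
def extension (p N : ℕ) : Formula N :=
  disj (ι := RelationData ⊕ (ℕ × List (ℕ × Bool))) (Sum.elim (relation N) fun q =>
    ⟨q.1 + min p 1, generation (N + (q.1 + min p 1)) q.2⟩)

/-- Failure of primitivity is existential, and the other disjuncts are existential over the Π_1
formulas `generation`. -/
theorem isSigma_extension (p N : ℕ) : IsSigma 2 (extension p N) := by
  refine isSigma_disj two_pos fun x => ?_
  rcases x with t | q
  · exact ⟨0, two_pos, .zero (isOpen_relation N t)⟩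
  · exact ⟨1, one_lt_two, isPi_generation _ _⟩

theorem exists_hasIndex_extension (p : ℕ) :
    ∃ g : ℕ → ℕ, Primrec g ∧ ∀ N, (extension p N).HasIndex (g N) := by
  obtain ⟨g, hg, hgi⟩ := exists_hasIndex_generation
  have hk : Primrec fun z : (ℕ × (RelationData ⊕ (ℕ × List (ℕ × Bool)))) × ℕ × List (ℕ × Bool) =>
      z.2.1 + min p 1 :=
    Primrec.nat_add.comp (Primrec.fst.comp Primrec.snd) (Primrec.const _)
  refine exists_hasIndex_disj (n := fun N : ℕ => N)
    (c := fun N x => Sum.casesOn x (relationIndex N) fun q => g (N + (q.1 + min p 1), q.2)) ?_ ?_ ?_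
  · refine (Primrec.sumCasesOn
      (f := fun y : ℕ × (RelationData ⊕ (ℕ × List (ℕ × Bool))) => y.2)
      (g := fun y t => (relation y.1 t).1) (h := fun _ q => q.1 + min p 1) Primrec.snd
      (primrec_relation_fst Primrec₂.right) hk.to₂).of_eq fun y => ?_
    obtain ⟨a, t | j⟩ := y <;> rfl
  · exact Primrec.sumCasesOn (f := fun y : ℕ × (RelationData ⊕ (ℕ × List (ℕ × Bool))) => y.2)
      (g := fun y t => relationIndex y.1 t) (h := fun y q => g (y.1 + (q.1 + min p 1), q.2))
      Primrec.snd (primrec_relationIndex.comp (Primrec.fst.comp Primrec.fst) Primrec.snd)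
      (hg.comp (Primrec.pair (Primrec.nat_add.comp (Primrec.fst.comp Primrec.fst) hk)
        (Primrec.snd.comp Primrec.snd)))
  · rintro N (t | q)
    · exact hasIndex_relation _ t
    · exact hgi (N + (q.1 + min p 1), q.2)

theorem realize_extension {G : Type*} [Group G] [Countable G] (p : ℕ) {N : ℕ} (hN : 0 < N)
    (f : ℕ → G) : (extension p N).Realize (fun i : Fin N => f i) ↔
      (IsPrimitiveTuple (N - 1) (fun i => f (i + 1)) → ∃ (m : ℕ) (g : ℕ → G),
        (∀ i < N - 1, g i = f (i + 1)) ∧ IsPrimitiveTuple (N - 1 + (m + min p 1)) g ∧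
          ∃ w, f 0 = FreeGroup.lift (truncate (N - 1 + (m + min p 1)) g) w) := by
  rw [extension, realize_disj, Sum.exists]
  simp only [Sum.elim_inl, Sum.elim_inr]
  rw [exists_realize_relation hN, imp_iff_not_or]
  refine or_congr_right ?_
  have hsub : ∀ m, N + (m + min p 1) - 1 = N - 1 + (m + min p 1) := fun m => by omega
  constructor
  · rintro ⟨⟨m, w⟩, g, hg, h⟩
    rw [realize_generation (by omega), hsub, hg 0 hN] at h
    exact ⟨m, fun i => g (i + 1), fun i hi => hg _ (by omega), h.1, _, h.2⟩
  · rintro ⟨m, g, hg, hp, w, hw⟩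
    -- `x_0` keeps its value, and the tuple `g` is shifted to `x_1`, `x_2`, ….
    refine ⟨(m, w.toWord), fun i => if i = 0 then f 0 else g (i - 1), fun i hi => ?_, ?_⟩
    · dsimp only
      by_cases h0 : i = 0
      · rw [if_pos h0, h0]
      · rw [if_neg h0, hg _ (by omega), Nat.sub_add_cancel (by omega)]
    · refine (realize_generation (by omega) w.toWord fun i => if i = 0 then f 0 else g (i - 1)).2 ?_
      rw [hsub, FreeGroup.mk_toWord]
      exact ⟨hp, hw⟩

/-- The axioms of groups. -/
def groupAxiom (N i : ℕ) : Formula N :=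
  if i = 0 then .eq (.mul (.mul (varTerm N 0) (varTerm N 1)) (varTerm N 2))
    (.mul (varTerm N 0) (.mul (varTerm N 1) (varTerm N 2)))
  else if i = 1 then .eq (.mul .one (varTerm N 0)) (varTerm N 0)
  else .eq (.mul (.inv (varTerm N 0)) (varTerm N 0)) .one

/-- The axioms of the free nilpotent group of class `p` on countably many generators. -/
def freeNilpotentAxiom (p : ℕ) :
    ℕ ⊕ (ℕ × ℕ) ⊕ (ℕ × List (ℕ × Bool)) ⊕ ℕ → Σ k, Formula (0 + k)
  | .inl i => ⟨3, groupAxiom _ i⟩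
  | .inr (.inl q) => ⟨q.1, .eq (wordTerm _ (lowerCentralWord p q.2)) .one⟩
  | .inr (.inr (.inl q)) => ⟨q.1 + 1, freeness p _ q.2⟩
  | .inr (.inr (.inr n)) => ⟨n + 1, extension p _⟩

/-- The Scott sentence of the free nilpotent group of class `p` on countably many generators. -/
def freeNilpotentSentence (p : ℕ) : Sentence := conj (freeNilpotentAxiom p)

theorem isPi_freeNilpotentSentence (p : ℕ) : IsPi 3 (freeNilpotentSentence p) := by
  refine isPi_conj three_pos fun x => ?_
  rcases x with i | q | q | n
  · refine ⟨0, by norm_num, .zero ?_⟩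
    dsimp only [freeNilpotentAxiom, groupAxiom]
    split
    · exact .eq _ _
    · split <;> exact .eq _ _
  · exact ⟨0, by norm_num, .zero (.eq _ _)⟩
  · exact ⟨1, by norm_num, isSigma_freeness _ _ _⟩
  · exact ⟨2, by norm_num, isSigma_extension _ _⟩

theorem isComputable_freeNilpotentSentence (p : ℕ) : (freeNilpotentSentence p).IsComputable := by
  obtain ⟨gf, hgf, hgfi⟩ := exists_hasIndex_freeness p
  obtain ⟨ge, hge, hgei⟩ := exists_hasIndex_extension p
  obtain ⟨c0, h0⟩ : ∃ c, (groupAxiom (0 + 3) 0).HasIndex c := by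
    simp [groupAxiom, HasIndex]
  obtain ⟨c1, h1⟩ : ∃ c, (groupAxiom (0 + 3) 1).HasIndex c := by
    simp [groupAxiom, HasIndex]
  obtain ⟨c2, h2⟩ : ∃ c, (groupAxiom (0 + 3) 2).HasIndex c := by
    simp [groupAxiom, HasIndex]
  have sum : ∀ {a : ℕ → ℕ} {b : ℕ × ℕ → ℕ} {c : ℕ × List (ℕ × Bool) → ℕ} {d : ℕ → ℕ},
      Primrec a → Primrec b → Primrec c → Primrec d →
      Primrec (Sum.elim a (Sum.elim b (Sum.elim c d))) := by
    intro a b c d ha hb hc hd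
    have elim : ∀ {α β : Type} [Primcodable α] [Primcodable β] {a : α → ℕ} {b : β → ℕ},
        Primrec a → Primrec b → Primrec (Sum.elim a b) := by
      intro α β _ _ a b ha hb
      refine (Primrec.sumCasesOn (f := fun x : α ⊕ β => x) (g := fun _ => a) (h := fun _ => b)
        Primrec.id (ha.comp Primrec.snd) (hb.comp Primrec.snd)).of_eq fun x => ?_
      cases x <;> rfl
    exact elim ha (elim hb (elim hc hd))
  obtain ⟨g, -, hg⟩ := exists_hasIndex_conj (σ := Unit) (n := fun _ => 0)
    (fam := fun _ => freeNilpotentAxiom p)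
    (c := fun _ => Sum.elim (fun i => if i = 0 then c0 else if i = 1 then c1 else c2)
      (Sum.elim (fun q => Nat.pair 0 (Nat.pair (wordIndex (0 + q.1) (lowerCentralWord p q.2))
        (Nat.pair 1 0))) (Sum.elim (fun q => gf (0 + (q.1 + 1), q.2)) fun n => ge (0 + (n + 1)))))
    (((sum (Primrec.const 3) Primrec.fst (Primrec.succ.comp Primrec.fst) Primrec.succ).comp
      Primrec.snd).of_eq fun y => by obtain ⟨_, i | q | q | n⟩ := y <;> rfl)
    ((sum (Primrec.ite (Primrec.eq.comp Primrec.id (Primrec.const 0)) (Primrec.const _)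
        (Primrec.ite (Primrec.eq.comp Primrec.id (Primrec.const 1)) (Primrec.const _)
          (Primrec.const _)))
      (Primrec₂.natPair.comp (Primrec.const 0) (Primrec₂.natPair.comp
        (primrec_wordIndex.comp (Primrec.nat_add.comp (Primrec.const 0) Primrec.fst)
          ((primrec_lowerCentralWord p).comp Primrec.snd)) (Primrec.const _)))
      (hgf.comp (Primrec.pair (Primrec.nat_add.comp (Primrec.const 0)
        (Primrec.succ.comp Primrec.fst)) Primrec.snd))
      (hge.comp (Primrec.nat_add.comp (Primrec.const 0) Primrec.succ))).comp Primrec.snd) (by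
    rintro _ (i | q | q | n)
    · dsimp only [freeNilpotentAxiom, Sum.elim_inl]
      by_cases hi0 : i = 0
      · subst hi0; exact h0
      by_cases hi1 : i = 1
      · subst hi1; exact h1
      rw [if_neg hi0, if_neg hi1]
      have : groupAxiom (0 + 3) i = groupAxiom (0 + 3) 2 := by simp [groupAxiom, hi0, hi1]
      rw [this]
      exact h2
    · dsimp only [freeNilpotentAxiom, Sum.elim_inl, Sum.elim_inr]
      rw [← code_wordTerm]; rfl
    · exact hgfi (0 + (q.1 + 1), q.2)
    · exact hgei _)
  exact ⟨_, hg ()⟩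

end Formula

-- Models of the sentence

open Formula

theorem models_freeNilpotentSentence {M : Type*} [Mul M] [Inv M] [One M] (p : ℕ) :
    Models M (freeNilpotentSentence p) ↔
      ∀ x, ∀ f : ℕ → M, (freeNilpotentAxiom p x).2.Realize
        (fun i : Fin (0 + (freeNilpotentAxiom p x).1) => f i) := by
  have : (Fin.elim0 : Fin 0 → M) = fun i : Fin 0 => (fun _ => 1 : ℕ → M) i := funext fun i => i.elim0
  rw [Models, this, freeNilpotentSentence, realize_conj (f := fun _ => (1 : M))]
  simp

/-- `Group.ofLeftAxioms` keeps the given operations, so the equalities hold by `rfl` and the group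
can replace the bare structure. -/
theorem exists_group_of_models {M : Type*} [hm : Mul M] [hi : Inv M] [ho : One M] {p : ℕ}
    (h : Models M (freeNilpotentSentence p)) :
    ∃ G : Group M, hm = G.toMul ∧ hi = G.toInv ∧ ho = G.toOne := by
  rw [models_freeNilpotentSentence] at h
  refine ⟨Group.ofLeftAxioms (fun a b c => ?_) (fun a => ?_) fun a => ?_, rfl, rfl, rfl⟩
  · simpa [freeNilpotentAxiom, groupAxiom, varTerm, Realize, Term.value] using
      h (.inl 0) fun i => if i = 0 then a else if i = 1 then b else c
  · simpa [freeNilpotentAxiom, groupAxiom, varTerm, Realize, Term.value] using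
      h (.inl 1) fun _ => a
  · simpa [freeNilpotentAxiom, groupAxiom, varTerm, Realize, Term.value] using
      h (.inl 2) fun _ => a

theorem models_iff_isFreeNilpotentLike {G : Type*} [Group G] [Countable G] (p : ℕ) :
    Models G (freeNilpotentSentence p) ↔ IsFreeNilpotentLike p G := by
  rw [models_freeNilpotentSentence]
  constructor
  · intro h
    refine ⟨?_, fun n f w hp hw => ?_, fun n f x hp => ?_⟩
    · obtain ⟨e, he⟩ := exists_surjective_nat G
      have hes : Function.Surjective (FreeGroup.lift e) := fun x => by
        obtain ⟨k, rfl⟩ := he x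
        exact ⟨FreeGroup.of k, FreeGroup.lift_apply_of⟩
      -- The lower central series of `G` is the image of that of the free group, so it suffices that
      -- enumerated words vanish.
      rw [← Subgroup.map_top_of_surjective _ hes, ← Subgroup.map_lowerCentralSeries,
        Subgroup.map_eq_bot_iff]
      intro u hu
      obtain ⟨j, rfl⟩ := (mem_lowerCentralSeries_iff_exists_word p u).1 hu
      obtain ⟨m, hm⟩ := exists_lift_truncate_eq (FreeGroup.mk (lowerCentralWord p j))
      -- The letters below `m` occupy `x_1, …, x_m`, and `x_0` is idle: `m + 1` variables suffice.
      have := h (.inr (.inl (m + 1, j))) fun i => e (i - 1)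
      simp only [freeNilpotentAxiom, Realize] at this
      rw [value_wordTerm _ _ fun i => e (i - 1), lift_truncate, hm _ (by omega)] at this
      exact this
    · have := h (.inr (.inr (.inl (n, w.toWord)))) fun i => f (i - 1)
      rw [freeNilpotentAxiom, realize_freeness p (Nat.add_pos_right 0 n.succ_pos) w.toWord fun i => f (i - 1),
        FreeGroup.mk_toWord] at this
      simp only [zero_add, Nat.add_sub_cancel] at this
      exact this hp hw
    · have := h (.inr (.inr (.inr n))) fun i => if i = 0 then x else f (i - 1)
      rw [freeNilpotentAxiom,
        realize_extension p (Nat.add_pos_right 0 n.succ_pos) fun i => if i = 0 then x else f (i - 1)] at this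
      simp only [zero_add, Nat.add_sub_cancel] at this
      exact this hp
  · rintro h (i | q | q | n) f
    · dsimp only [freeNilpotentAxiom, groupAxiom]
      split
      · exact mul_assoc _ _ _
      · split
        · exact one_mul _
        · exact inv_mul_cancel _
    · simp only [freeNilpotentAxiom, Realize, value_wordTerm]
      have hu := (mem_lowerCentralSeries_iff_exists_word p _).2 ⟨q.2, rfl⟩
      have := Subgroup.mem_map_of_mem
        (FreeGroup.lift (truncate (0 + q.1 - 1) fun i => f (i + 1))) hu
      rw [Subgroup.map_lowerCentralSeries] at this
      have : _ ∈ (⊤ : Subgroup G).lowerCentralSeries p := Subgroup.lowerCentralSeries_mono p le_top this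
      rwa [h.nilpotent, Subgroup.mem_bot] at this
    · simp only [freeNilpotentAxiom]
      rw [realize_freeness p (by omega)]
      exact h.free _ _ _
    · simp only [freeNilpotentAxiom]
      rw [realize_extension p (by omega)]
      exact h.extend _ _ _

theorem isScottSentence_freeNilpotentSentence (p : ℕ) :
    IsScottSentence.{u, 0} (freeNilpotentSentence p) (FreeNilpotentGroup p ℕ) := by
  intro M hm hi ho _
  constructor
  · intro h
    obtain ⟨G, rfl, rfl, rfl⟩ := exists_group_of_models h
    obtain ⟨e⟩ := ((models_iff_isFreeNilpotentLike p).1 h).nonempty_mulEquiv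
    exact ⟨e, map_one e, map_inv e⟩
  · rintro ⟨e, h1, hinv⟩
    have : Countable (FreeNilpotentGroup p ℕ) := (Quotient.mk_surjective).countable
    have h := (models_iff_isFreeNilpotentLike p).2 (FreeNilpotentGroup.isFreeNilpotentLike (p := p))
    rw [Models, ← realize_map e h1 hinv]
    rw [Models] at h
    -- Both assignments are functions on the empty type `Fin 0`.
    convert h

end GroupLogic

theorem mainTheorem6 (p : ℕ) :
    ∃ φ : GroupLogic.Sentence, φ.IsPi 3 ∧ φ.IsComputable ∧
      GroupLogic.IsScottSentence.{u, 0} φ (FreeNilpotentGroup p ℕ) :=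
  ⟨GroupLogic.Formula.freeNilpotentSentence p, GroupLogic.Formula.isPi_freeNilpotentSentence p,
    GroupLogic.Formula.isComputable_freeNilpotentSentence p,
    GroupLogic.isScottSentence_freeNilpotentSentence p⟩
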